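/- Let $\Gamma$ be a connected compact metric graph, i.e. a connected graph with finitely many vertices and edges (loops and multiple edges allowed) in which each edge $e$ is given a direction, a length $\ell_e\in(0,\infty)$ and a coordinate $x\in[0,\ell_e]$. Let $V_D$ be a non-empty set of vertices of $\Gamma$ and let $1<p<\infty$. A function $u$ on $\Gamma$ is a family of functions $u_e$ on $[0,\ell_e]$, one for each edge, and $\int_\Gamma u\,dx=\sum_e\int_0^{\ell_e}u_e\,dx$. Let $\mathcal X(\Gamma,V_D)$ be the set of functions $u$ that are continuous on $\Gamma$ (on each closed edge, with a common value at each vertex), satisfy $u_e\in W^{1,p}(0,\ell_e)$ for every edge $e$, and vanish at the vertices of $V_D$. A nonzero $u\in\mathcal X(\Gamma,V_D)$ is an eigenfunction associated to $\lambda\in\mathbb R$ if $$\int_\Gamma|u'|^{p-2}u'w'\,dx=\lambda\int_\Gamma|u|^{p-2}u\,w\,dx\qquad\text{for all } w\in\mathcal X(\Gamma,V_D).$$ Let $$\lambda_{1,p}(\Gamma,V_D)=\inf\left\{\frac{\int_\Gamma|u'|^p\,dx}{\int_\Gamma|u|^p\,dx}\colon u\in\mathcal X(\Gamma,V_D),\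 u\neq0\right\}.$$ Fix an edge $e_0$. For $\delta>-\ell_{e_0}$ let $\Gamma_\delta$ be the metric graph obtained from $\Gamma$ by replacing the length $\ell_{e_0}$ by $\ell_{e_0}+\delta$ and leaving everything else unchanged, and put $\lambda(\delta)=\lambda_{1,p}(\Gamma_\delta,V_D)$. Suppose that $\lambda_{1,p}(\Gamma,V_D)$ is simple, i.e. any two eigenfunctions associated to it are proportional. Then $\lambda(\delta)$ is differentiable at $\delta=0$, there is an eigenfunction $u_0$ associated to $\lambda(0)=\lambda_{1,p}(\Gamma,V_D)$ with $\|u_0\|_{L^p(\Gamma)}=1$, and for every such $u_0$ $$\lambda'(0)=-\frac{p-1}{\ell_{e_0}}\int_0^{\ell_{e_0}}|u_0'(x)|^p\,dx-\frac{\lambda(0)}{\ell_{e_0}}\int_0^{\ell_{e_0}}|u_0(x)|^p\,dx .$$ -/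

import Mathlib

open MeasureTheory Set
open scoped ContDiff

/-! ### Sobolev functions on a bounded interval -/

/-- `g` is a weak derivative of `f` on the open interval `(0, L)`: both are locally integrable
there and `∫ f φ' = - ∫ g φ` for every `φ ∈ C_c^∞(0, L)`. -/
def IsWeakDeriv (L : ℝ) (f g : ℝ → ℝ) : Prop :=
  LocallyIntegrableOn f (Ioo 0 L) ∧ LocallyIntegrableOn g (Ioo 0 L) ∧
    ∀ φ : ℝ → ℝ, ContDiff ℝ ∞ φ → HasCompactSupport φ → tsupport φ ⊆ Ioo 0 L →
      ∫ x in Ioo 0 L, f x * deriv φ x = - ∫ x in Ioo 0 L, g x * φ x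

open Classical in
/-- A representative of the weak derivative of `f` on `(0, L)` (it is unique up to a null set),
and `0` if there is none. -/
noncomputable def weakDeriv (L : ℝ) (f : ℝ → ℝ) : ℝ → ℝ :=
  if h : ∃ g, IsWeakDeriv L f g then h.choose else 0

/-- `f ∈ W^{1,p}(0, L)`: `f ∈ L^p(0, L)` and `f` has a weak derivative in `L^p(0, L)`. -/
def MemW1p (L p : ℝ) (f : ℝ → ℝ) : Prop :=
  MemLp f (ENNReal.ofReal p) (volume.restrict (Ioo 0 L)) ∧
    ∃ g, IsWeakDeriv L f g ∧ MemLp g (ENNReal.ofReal p) (volume.restrict (Ioo 0 L))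

/-! ### Metric graphs -/

/-- A metric graph with vertices `V` and edges `E`, all of finite length (loops and multiple
edges are allowed). The edge `e` is directed from `src e` to `tgt e` and carries a coordinate
`x ∈ [0, length e]` that increases from `src e` to `tgt e`. For finite `V` and `E` these are the
compact metric graphs. -/
structure MetricGraph (V E : Type*) where
  src : E → V
  tgt : E → V
  length : E → ℝ
  length_pos : ∀ e, 0 < length e

namespace MetricGraph

variable {V E : Type*} (Γ : MetricGraph V E)

/-- The graph is connected (directions are ignored; the vertex set is non-empty). -/
def Connected : Prop :=
  (SimpleGraph.fromRel fun v w => ∃ e, Γ.src e = v ∧ Γ.tgt e = w).Connected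

/-- The integral over the graph of a function, which is a family of functions of the edge
coordinates; only the values `f e x` with `x ∈ [0, length e]` matter. -/
noncomputable def integral [Fintype E] (f : E → ℝ → ℝ) : ℝ :=
  ∑ e, ∫ x in (0 : ℝ)..Γ.length e, f e x

/-- The norm of `L^p(Γ)`. -/
noncomputable def lpNorm [Fintype E] (p : ℝ) (u : E → ℝ → ℝ) : ℝ :=
  (Γ.integral fun e x => |u e x| ^ p) ^ (1 / p)

/-- The derivative `u'`, taken edge by edge in the weak sense. -/
noncomputable def grad (u : E → ℝ → ℝ) : E → ℝ → ℝ :=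
  fun e => weakDeriv (Γ.length e) (u e)

/-- `u` is continuous on the graph: it is continuous on each closed edge, and at each vertex the
functions on all incident edges take the same value. -/
def IsContinuous (u : E → ℝ → ℝ) : Prop :=
  (∀ e, ContinuousOn (u e) (Icc 0 (Γ.length e))) ∧
    ∃ val : V → ℝ, ∀ e, u e 0 = val (Γ.src e) ∧ u e (Γ.length e) = val (Γ.tgt e)

/-- `u ∈ W^{1,p}(Γ)`. -/
def MemSobolev (p : ℝ) (u : E → ℝ → ℝ) : Prop :=
  Γ.IsContinuous u ∧ ∀ e, MemW1p (Γ.length e) p (u e)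

/-- `u ∈ 𝒳(Γ, V_D)`: `u ∈ W^{1,p}(Γ)` and `u = 0` at the vertices of `VD`. -/
def MemX (p : ℝ) (VD : Set V) (u : E → ℝ → ℝ) : Prop :=
  Γ.MemSobolev p u ∧
    ∀ e, (Γ.src e ∈ VD → u e 0 = 0) ∧ (Γ.tgt e ∈ VD → u e (Γ.length e) = 0)

/-- `u` is not the zero function on the graph. -/
def IsNontrivial (u : E → ℝ → ℝ) : Prop :=
  ∃ e, ∃ x ∈ Icc 0 (Γ.length e), u e x ≠ 0

/-- `u` is an eigenfunction of the `p`-Laplacian associated to `lam`. -/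
def IsEigenfunction [Fintype E] (p : ℝ) (VD : Set V) (lam : ℝ) (u : E → ℝ → ℝ) : Prop :=
  Γ.MemX p VD u ∧ Γ.IsNontrivial u ∧
    ∀ w, Γ.MemX p VD w →
      Γ.integral (fun e x => |Γ.grad u e x| ^ (p - 2) * Γ.grad u e x * Γ.grad w e x) =
        lam * Γ.integral (fun e x => |u e x| ^ (p - 2) * u e x * w e x)

/-- The first eigenvalue `λ_{1,p}(Γ, V_D)`, the infimum of the Rayleigh quotients. -/
noncomputable def firstEigenvalue [Fintype E] (p : ℝ) (VD : Set V) : ℝ :=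
  sInf {r | ∃ u, Γ.MemX p VD u ∧ Γ.IsNontrivial u ∧
    r = Γ.integral (fun e x => |Γ.grad u e x| ^ p) / Γ.integral (fun e x => |u e x| ^ p)}

/-- Simplicity of `lam`: an eigenfunction associated to `lam` is unique up to a constant factor.
(That there is an eigenfunction is not part of this condition.) -/
def IsSimple [Fintype E] (p : ℝ) (VD : Set V) (lam : ℝ) : Prop :=
  ∀ u v, Γ.IsEigenfunction p VD lam u → Γ.IsEigenfunction p VD lam v →
    ∃ c : ℝ, ∀ e, ∀ x ∈ Icc 0 (Γ.length e), v e x = c * u e x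

open Classical in
/-- The graph `Γ_δ`: the length of `e₀` becomes `ℓ_{e₀} + δ`, nothing else changes. -/
noncomputable def perturb (e₀ : E) (δ : ℝ) (h : 0 < Γ.length e₀ + δ) : MetricGraph V E where
  src := Γ.src
  tgt := Γ.tgt
  length e := if e = e₀ then Γ.length e₀ + δ else Γ.length e
  length_pos e := by
    split_ifs
    · exact h
    · exact Γ.length_pos e

/-- The function `λ(δ) = λ_{1,p}(Γ_δ, V_D)` for `δ > -ℓ_{e₀}`; the value for other `δ`, where
there is no graph `Γ_δ`, is irrelevant. -/
noncomputable def perturbedEigenvalue [Fintype E] (p : ℝ) (VD : Set V) (e₀ : E) (δ : ℝ) : ℝ :=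
  if h : 0 < Γ.length e₀ + δ then (Γ.perturb e₀ δ h).firstEigenvalue p VD else 0

theorem perturbedEigenvalue_zero [Fintype E] (p : ℝ) (VD : Set V) (e₀ : E) :
    Γ.perturbedEigenvalue p VD e₀ 0 = Γ.firstEigenvalue p VD := by
  have h : 0 < Γ.length e₀ + 0 := by simpa using Γ.length_pos e₀
  have hΓ : Γ.perturb e₀ 0 h = Γ := by
    cases Γ
    simp only [perturb, mk.injEq, true_and]
    funext e
    split_ifs with he
    · simp [he]
    · rfl
  rw [perturbedEigenvalue, dif_pos h, hΓ]

end MetricGraph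

/-! The edge `e₀` is rescaled linearly, so that all the graphs Γ_δ share one function space. Write ℓ
for the length of `e₀`. For v of total mass ∫|v|^p = 1, let G be its energy ∫|v'|^p on Γ, and b and
d the energy and the mass on `e₀` alone. The Rayleigh quotient of the transplanted function on Γ_δ
is (G + ((1 + δ/ℓ)^(1-p) - 1) b) / (1 + (δ/ℓ) d), and λ(δ) is the infimum of these quotients.

Differentiating the infimum is an envelope argument, `hasDerivAt_of_stable_minimizers`. A fixed
minimizer, with values b₀ and d₀, bounds λ(δ) from above. Minimizers up to an error δ² bound it from
below, and they are also nearly minimal for δ = 0. If this forces their b and d towards b₀ and d₀,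
both bounds have the slope ((1-p) b₀ - λ(0) d₀)/ℓ.

The required stability is `IsSimple.exists_stability`. By `exists_subseq_tendsto_minimizer` a
normalized minimizing sequence has a subsequence whose edge energies and masses converge to those of
a minimizer: Arzelà–Ascoli gives uniform convergence, midpoints then keep almost all the mass, and
the Rayleigh inequality for midpoints with the uniform convexity of L^p makes the gradients strongly
Cauchy. Minimizers are eigenfunctions, so by simplicity two normalized ones differ by a factor of
modulus 1 and have the same b and d.

Weak derivatives are handled through `IsLpPrimitive`: a continuous W^{1,p} function on an interval
is a primitive of its weak derivative. -/

/-! ### Weak derivatives and primitives on an interval -/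

/-- If a smooth function supported in `(0, L)` has zero mean, its primitive is again a test
function. -/
theorem exists_testFunction_deriv_eq {L : ℝ} (hL : 0 < L) {ψ : ℝ → ℝ} (hψ : ContDiff ℝ ∞ ψ)
    (hc : HasCompactSupport ψ) (hs : tsupport ψ ⊆ Ioo 0 L) (h0 : ∫ x in Ioo 0 L, ψ x = 0) :
    ∃ φ : ℝ → ℝ, ContDiff ℝ ∞ φ ∧ HasCompactSupport φ ∧ tsupport φ ⊆ Ioo 0 L ∧ deriv φ = ψ := by
  -- The point L/2 keeps the compact set non-empty when ψ = 0.
  have hK : IsCompact (insert (L / 2) (tsupport ψ)) := IsCompact.insert hc _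
  obtain ⟨a, ha⟩ := hK.exists_isLeast (insert_nonempty _ _)
  obtain ⟨b, hb⟩ := hK.exists_isGreatest (insert_nonempty _ _)
  have hsub : insert (L / 2) (tsupport ψ) ⊆ Ioo 0 L :=
    insert_subset ⟨by linarith, by linarith⟩ hs
  have ha0 := (hsub ha.1).1
  have hbL := (hsub hb.1).2
  have hzero : ∀ x, x ∉ Icc a b → ψ x = 0 := fun x hx => by
    by_contra hne
    have : x ∈ tsupport ψ := subset_tsupport _ hne
    exact hx ⟨ha.2 (mem_insert_of_mem _ this), hb.2 (mem_insert_of_mem _ this)⟩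
  have hder : ∀ x, HasDerivAt (fun x => ∫ t in a..x, ψ t) (ψ x) x := fun x =>
    intervalIntegral.integral_hasDerivAt_right (hψ.continuous.intervalIntegrable _ _)
      hψ.continuous.stronglyMeasurable.stronglyMeasurableAtFilter hψ.continuous.continuousAt
  have hderiv : deriv (fun x => ∫ t in a..x, ψ t) = ψ := funext fun x => (hder x).deriv
  have hcont : ∀ x y, IntervalIntegrable ψ volume x y :=
    fun x y => hψ.continuous.intervalIntegrable _ _
  have hz1 : ∀ x, x ≤ a → ∫ t in a..x, ψ t = 0 := fun x hx => by
    rw [intervalIntegral.integral_symm, intervalIntegral.integral_zero_ae, neg_zero]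
    have : ∀ᵐ t : ℝ, t ≠ a := by simp [ae_iff, measure_singleton]
    filter_upwards [this] with t hta ht
    rw [uIoc_of_le hx] at ht
    exact hzero t fun h => hta (le_antisymm ht.2 h.1)
  have hz2 : ∀ x, b ≤ x → ∫ t in b..x, ψ t = 0 := fun x hx => by
    rw [intervalIntegral.integral_zero_ae]
    refine Filter.Eventually.of_forall fun t ht => ?_
    rw [uIoc_of_le hx] at ht
    exact hzero t fun h => absurd h.2 (not_le.2 ht.1)
  have htot : ∫ t in a..b, ψ t = 0 := by
    rw [← integral_Ioc_eq_integral_Ioo, ← intervalIntegral.integral_of_le hL.le,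
      ← intervalIntegral.integral_add_adjacent_intervals (hcont 0 a) (hcont a L),
      ← intervalIntegral.integral_add_adjacent_intervals (hcont a b) (hcont b L), hz2 L hbL.le,
      intervalIntegral.integral_symm, hz1 0 ha0.le] at h0
    linarith
  have hsupp : tsupport (fun x => ∫ t in a..x, ψ t) ⊆ Icc a b := by
    refine closure_minimal (fun x hx => ?_) isClosed_Icc
    by_contra hn
    rw [mem_Icc, not_and_or, not_le, not_le] at hn
    refine hx ?_
    rcases hn with h | h
    · exact hz1 x h.le
    · show ∫ t in a..x, ψ t = 0
      rw [← intervalIntegral.integral_add_adjacent_intervals (hcont a b) (hcont b x), htot,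
        hz2 x h.le, add_zero]
  refine ⟨fun x => ∫ t in a..x, ψ t, ?_, ?_, ?_, hderiv⟩
  · rw [contDiff_infty_iff_deriv, hderiv]
    exact ⟨fun x => (hder x).differentiableAt, hψ⟩
  · exact HasCompactSupport.of_support_subset_isCompact isCompact_Icc
      ((subset_tsupport _).trans hsupp)
  · exact hsupp.trans fun x hx => ⟨ha0.trans_le hx.1, hx.2.trans_lt hbL⟩

/-- A product of a locally integrable function and a test function is integrable. -/
theorem integrableOn_mul_testFunction {L : ℝ} {f φ : ℝ → ℝ}
    (hf : LocallyIntegrableOn f (Ioo 0 L)) (hφ : Continuous φ) (hc : HasCompactSupport φ)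
    (hs : tsupport φ ⊆ Ioo 0 L) : IntegrableOn (fun x => f x * φ x) (Ioo 0 L) := by
  have h1 : IntegrableOn f (tsupport φ) := hf.integrableOn_compact_subset hs hc
  have h2 : IntegrableOn (fun x => f x * φ x) (tsupport φ) :=
    h1.mul_continuousOn hφ.continuousOn hc
  have h3 : Integrable (fun x => f x * φ x) := by
    rw [← integrableOn_iff_integrable_of_support_subset (s := tsupport φ)]
    · exact h2
    · intro x hx
      refine subset_tsupport _ fun h0 => hx ?_
      simp only [h0, mul_zero]
  exact h3.integrableOn

/-- Locally integrable functions that agree against all test functions are equal a.e. -/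
theorem ae_eq_zero_of_integral_mul_testFunction {L : ℝ} {f : ℝ → ℝ}
    (hf : LocallyIntegrableOn f (Ioo 0 L))
    (H : ∀ φ : ℝ → ℝ, ContDiff ℝ ∞ φ → HasCompactSupport φ → tsupport φ ⊆ Ioo 0 L →
      ∫ x in Ioo 0 L, f x * φ x = 0) :
    ∀ᵐ x ∂volume.restrict (Ioo 0 L), f x = 0 := by
  rw [ae_restrict_iff' measurableSet_Ioo]
  refine isOpen_Ioo.ae_eq_zero_of_integral_contDiff_smul_eq_zero hf fun φ h1 h2 h3 => ?_
  rw [← H φ h1 h2 h3, setIntegral_eq_integral_of_forall_compl_eq_zero]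
  · simp only [smul_eq_mul, mul_comm]
  · intro x hx
    rw [image_eq_zero_of_notMem_tsupport fun h => hx (h3 h), mul_zero]

/-- The lemma of du Bois-Reymond on an interval. -/
theorem eqOn_const_of_integral_mul_deriv_eq_zero {L : ℝ} (hL : 0 < L) {h : ℝ → ℝ}
    (hc : ContinuousOn h (Icc 0 L))
    (H : ∀ φ : ℝ → ℝ, ContDiff ℝ ∞ φ → HasCompactSupport φ → tsupport φ ⊆ Ioo 0 L →
      ∫ x in Ioo 0 L, h x * deriv φ x = 0) :
    ∃ c, ∀ x ∈ Icc 0 L, h x = c := by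
  let bump : ContDiffBump (L / 2) := ⟨L / 8, L / 4, by linarith, by linarith⟩
  set ρ : ℝ → ℝ := bump.normed volume with hρ
  have hρs : tsupport ρ ⊆ Ioo 0 L := by
    rw [hρ, bump.tsupport_normed_eq]
    intro x hx
    rw [Real.closedBall_eq_Icc] at hx
    have h1 : L / 2 - L / 4 ≤ x := hx.1
    have h2 : x ≤ L / 2 + L / 4 := hx.2
    constructor <;> linarith
  have hρc : HasCompactSupport ρ := bump.hasCompactSupport_normed
  have hρd : ContDiff ℝ ∞ ρ := bump.contDiff_normed
  have hρ1 : ∫ x in Ioo 0 L, ρ x = 1 := by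
    rw [setIntegral_eq_integral_of_forall_compl_eq_zero, bump.integral_normed]
    intro x hx
    exact image_eq_zero_of_notMem_tsupport fun h => hx (hρs h)
  have hloc : LocallyIntegrableOn h (Ioo 0 L) :=
    (hc.mono Ioo_subset_Icc_self).locallyIntegrableOn measurableSet_Ioo
  set c := ∫ x in Ioo 0 L, h x * ρ x with hcdef
  have hae : ∀ᵐ x ∂volume.restrict (Ioo 0 L), h x - c = 0 := by
    refine ae_eq_zero_of_integral_mul_testFunction
      (hloc.sub (locallyIntegrableOn_const c)) fun ψ h1 h2 h3 => ?_
    have i1 : IntegrableOn ψ (Ioo 0 L) := (h1.continuous.integrable_of_hasCompactSupport h2).integrableOn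
    have i2 : IntegrableOn ρ (Ioo 0 L) := (hρd.continuous.integrable_of_hasCompactSupport hρc).integrableOn
    have i3 := integrableOn_mul_testFunction hloc h1.continuous h2 h3
    have i4 := integrableOn_mul_testFunction hloc hρd.continuous hρc hρs
    -- ψ - mρ has mean zero and is thus the derivative of a test function, so `H` gives ∫hψ = m∫hρ =
    -- c∫ψ.
    set m := ∫ x in Ioo 0 L, ψ x with hm
    have hss : tsupport (fun x => ψ x - m * ρ x) ⊆ tsupport ψ ∪ tsupport ρ := by
      refine closure_minimal (fun x hx => ?_) ((isClosed_tsupport _).union (isClosed_tsupport _))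
      by_contra hn
      rw [mem_union, not_or] at hn
      refine hx ?_
      simp only [image_eq_zero_of_notMem_tsupport hn.1, image_eq_zero_of_notMem_tsupport hn.2,
        mul_zero, sub_zero]
    obtain ⟨φ, p1, p2, p3, p4⟩ := exists_testFunction_deriv_eq hL (ψ := fun x => ψ x - m * ρ x)
      (h1.sub (contDiff_const.mul hρd))
      (HasCompactSupport.of_support_subset_isCompact (IsCompact.union h2 hρc)
        ((subset_tsupport _).trans hss))
      (hss.trans (union_subset h3 hρs))
      (by rw [integral_sub i1 (i2.const_mul m), integral_const_mul, hρ1]; simp [hm])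
    have key := H φ p1 p2 p3
    rw [p4] at key
    have e1 : ∀ x, h x * (ψ x - m * ρ x) = h x * ψ x - m * (h x * ρ x) := fun x => by ring
    simp only [e1] at key
    rw [integral_sub i3 (i4.const_mul m), integral_const_mul] at key
    have e2 : ∀ x, (h x - c) * ψ x = h x * ψ x - c * ψ x := fun x => by ring
    simp only [e2]
    rw [integral_sub i3 (i1.const_mul c), integral_const_mul]
    linarith
  refine ⟨c, fun x hx => ?_⟩
  refine Measure.eqOn_Icc_of_ae_eq volume hL.ne (f := h) (g := fun _ => c) ?_ hc continuousOn_const hx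
  rw [Measure.restrict_congr_set Ioo_ae_eq_Icc.symm]
  filter_upwards [hae] with x hx using by simpa [sub_eq_zero] using hx

theorem MemLp.intervalIntegrable_of_restrict_Ioo {L p : ℝ} (hL : 0 < L) (hp : 1 ≤ p) {g : ℝ → ℝ}
    (h : MemLp g (ENNReal.ofReal p) (volume.restrict (Ioo 0 L))) :
    IntervalIntegrable g volume 0 L := by
  rw [intervalIntegrable_iff_integrableOn_Ioo_of_le hL.le]
  exact h.integrable (by simpa using hp)

/-- Integration by parts of a primitive of an integrable function against a test function. -/
theorem integral_primitive_mul_deriv {L : ℝ} (hL : 0 < L) {g : ℝ → ℝ}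
    (hg : IntervalIntegrable g volume 0 L) (c : ℝ) {φ : ℝ → ℝ} (hφ : ContDiff ℝ ∞ φ)
    (hs : tsupport φ ⊆ Ioo 0 L) :
    ∫ x in Ioo 0 L, (c + ∫ t in (0 : ℝ)..x, g t) * deriv φ x = - ∫ x in Ioo 0 L, g x * φ x := by
  have hac : AbsolutelyContinuousOnInterval (fun x => c + ∫ t in (0 : ℝ)..x, g t) 0 L :=
    (contDiff_const (n := 1).contDiffOn.absolutelyContinuousOnInterval).fun_add
      (hg.absolutelyContinuousOnInterval_intervalIntegral left_mem_uIcc)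
  have hφac : AbsolutelyContinuousOnInterval φ 0 L :=
    (hφ.of_le (by exact_mod_cast le_top)).contDiffOn.absolutelyContinuousOnInterval
  have key := hac.integral_mul_deriv_eq_deriv_mul hφac
  have z0 : φ 0 = 0 := image_eq_zero_of_notMem_tsupport fun h => lt_irrefl _ (hs h).1
  have zL : φ L = 0 := image_eq_zero_of_notMem_tsupport fun h => lt_irrefl _ (hs h).2
  rw [z0, zL, mul_zero, mul_zero, sub_zero, zero_sub] at key
  rw [← integral_Ioc_eq_integral_Ioo, ← integral_Ioc_eq_integral_Ioo,
    ← intervalIntegral.integral_of_le hL.le, ← intervalIntegral.integral_of_le hL.le, key]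
  congr 1
  apply intervalIntegral.integral_congr_ae
  filter_upwards [hg.ae_hasDerivAt_integral] with x hx hxm
  have := (hx (uIoc_subset_uIcc hxm) 0 left_mem_uIcc).const_add c
  rw [this.deriv]

/-- `f` is on `[0, L]` a primitive of the function `g`, which is in `L^p(0, L)`. -/
structure IsLpPrimitive (L p : ℝ) (f g : ℝ → ℝ) : Prop where
  memLp : MemLp g (ENNReal.ofReal p) (volume.restrict (Ioo 0 L))
  eq : ∀ x ∈ Icc 0 L, f x = f 0 + ∫ t in (0 : ℝ)..x, g t

namespace IsLpPrimitive

variable {L p : ℝ} {f g : ℝ → ℝ}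

theorem intervalIntegrable (h : IsLpPrimitive L p f g) (hL : 0 < L) (hp : 1 ≤ p) :
    IntervalIntegrable g volume 0 L :=
  MemLp.intervalIntegrable_of_restrict_Ioo hL hp h.memLp

theorem continuousOn (h : IsLpPrimitive L p f g) (hL : 0 < L) (hp : 1 ≤ p) :
    ContinuousOn f (Icc 0 L) := by
  have h1 := intervalIntegral.continuousOn_primitive_interval' (h.intervalIntegrable hL hp)
    (a := 0) left_mem_uIcc
  rw [uIcc_of_le hL.le] at h1
  exact (continuousOn_const.add h1).congr h.eq

theorem isWeakDeriv (h : IsLpPrimitive L p f g) (hL : 0 < L) (hp : 1 ≤ p) :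
    IsWeakDeriv L f g := by
  refine ⟨((h.continuousOn hL hp).mono Ioo_subset_Icc_self).locallyIntegrableOn measurableSet_Ioo,
    ?_, fun φ h1 h2 h3 => ?_⟩
  · exact IntegrableOn.locallyIntegrableOn (h.memLp.integrable (by simpa using hp))
  · rw [← integral_primitive_mul_deriv hL (h.intervalIntegrable hL hp) (f 0) h1 h3]
    refine setIntegral_congr_fun measurableSet_Ioo fun x hx => ?_
    rw [h.eq x (Ioo_subset_Icc_self hx)]

theorem memW1p (h : IsLpPrimitive L p f g) (hL : 0 < L) (hp : 1 ≤ p) : MemW1p L p f := by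
  refine ⟨?_, g, h.isWeakDeriv hL hp, h.memLp⟩
  have hc := h.continuousOn hL hp
  obtain ⟨C, hC⟩ := isCompact_Icc.exists_bound_of_continuousOn hc
  refine MemLp.of_bound ((hc.mono Ioo_subset_Icc_self).aestronglyMeasurable measurableSet_Ioo) C ?_
  rw [ae_restrict_iff' measurableSet_Ioo]
  exact Filter.Eventually.of_forall fun x hx => hC x (Ioo_subset_Icc_self hx)

end IsLpPrimitive

/-- Since `weakDeriv` is an arbitrary choice, uniqueness almost everywhere is what allows it to be
computed. -/
theorem IsWeakDeriv.ae_eq {L : ℝ} {f g₁ g₂ : ℝ → ℝ} (h₁ : IsWeakDeriv L f g₁)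
    (h₂ : IsWeakDeriv L f g₂) : g₁ =ᵐ[volume.restrict (Ioo 0 L)] g₂ := by
  have := ae_eq_zero_of_integral_mul_testFunction (h₁.2.1.sub h₂.2.1) fun φ p1 p2 p3 => by
    have i1 := integrableOn_mul_testFunction h₁.2.1 p1.continuous p2 p3
    have i2 := integrableOn_mul_testFunction h₂.2.1 p1.continuous p2 p3
    simp only [Pi.sub_apply, sub_mul]
    rw [integral_sub i1 i2]
    have e1 := h₁.2.2 φ p1 p2 p3
    have e2 := h₂.2.2 φ p1 p2 p3
    linarith
  filter_upwards [this] with x hx using by simpa [sub_eq_zero] using hx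

theorem IsWeakDeriv.weakDeriv_ae_eq {L : ℝ} {f g : ℝ → ℝ} (h : IsWeakDeriv L f g) :
    weakDeriv L f =ᵐ[volume.restrict (Ioo 0 L)] g := by
  have hex : ∃ g, IsWeakDeriv L f g := ⟨g, h⟩
  rw [weakDeriv, dif_pos hex]
  exact hex.choose_spec.ae_eq h

theorem IsLpPrimitive.weakDeriv_ae_eq {L p : ℝ} {f g : ℝ → ℝ} (h : IsLpPrimitive L p f g)
    (hL : 0 < L) (hp : 1 ≤ p) : weakDeriv L f =ᵐ[volume.restrict (Ioo 0 L)] g :=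
  (h.isWeakDeriv hL hp).weakDeriv_ae_eq

/-- A continuous function in `W^{1,p}(0, L)` is a primitive of its weak derivative. -/
theorem MemW1p.isLpPrimitive {L p : ℝ} (hL : 0 < L) (hp : 1 ≤ p) {f : ℝ → ℝ}
    (hf : MemW1p L p f) (hc : ContinuousOn f (Icc 0 L)) :
    IsLpPrimitive L p f (weakDeriv L f) := by
  obtain ⟨-, g, hg, hgp⟩ := hf
  have hmem : MemLp (weakDeriv L f) (ENNReal.ofReal p) (volume.restrict (Ioo 0 L)) :=
    hgp.ae_eq hg.weakDeriv_ae_eq.symm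
  have hex : ∃ g, IsWeakDeriv L f g := ⟨g, hg⟩
  have hw : IsWeakDeriv L f (weakDeriv L f) := by
    rw [weakDeriv, dif_pos hex]
    exact hex.choose_spec
  have hint : IntervalIntegrable (weakDeriv L f) volume 0 L :=
    MemLp.intervalIntegrable_of_restrict_Ioo hL hp hmem
  have hcp := intervalIntegral.continuousOn_primitive_interval' hint (a := 0) left_mem_uIcc
  rw [uIcc_of_le hL.le] at hcp
  -- The function and the primitive of its weak derivative have the same weak derivative, so their
  -- difference is constant by du Bois-Reymond.
  obtain ⟨c, hc'⟩ := eqOn_const_of_integral_mul_deriv_eq_zero hL (hc.sub hcp)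
    fun φ p1 p2 p3 => by
      have hd2 : HasCompactSupport (deriv φ) := p2.deriv
      have hd3 : tsupport (deriv φ) ⊆ Ioo 0 L := (tsupport_deriv_subset).trans p3
      have hdc : Continuous (deriv φ) := (contDiff_infty_iff_deriv.1 p1).2.continuous
      have i1 := integrableOn_mul_testFunction hw.1 hdc hd2 hd3
      have i2 := integrableOn_mul_testFunction
        ((hcp.mono Ioo_subset_Icc_self).locallyIntegrableOn measurableSet_Ioo) hdc hd2 hd3
      have e1 := hw.2.2 φ p1 p2 p3
      have e2 := integral_primitive_mul_deriv hL hint 0 p1 p3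
      simp only [zero_add] at e2
      simp only [Pi.sub_apply, sub_mul]
      rw [integral_sub i1 i2, e1, e2, sub_self]
  refine ⟨hmem, fun x hx => ?_⟩
  have h0 := hc' 0 ⟨le_rfl, hL.le⟩
  have h1 := hc' x hx
  simp only [Pi.sub_apply, intervalIntegral.integral_same] at h0 h1
  linarith

/-! ### Arzelà–Ascoli on finitely many intervals -/

open Filter Topology in
/-- Arzelà–Ascoli for families of functions on finitely many intervals. -/
theorem exists_subseq_uniformCauchy {E : Type*} [Fintype E] {l : E → ℝ} (hl : ∀ e, 0 < l e)
    {u : ℕ → E → ℝ → ℝ} {M : ℝ} (hM : ∀ n e, ∀ x ∈ Icc 0 (l e), |u n e x| ≤ M)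
    (hu : ∀ ε > 0, ∃ δ > 0, ∀ n e, ∀ x ∈ Icc 0 (l e), ∀ y ∈ Icc 0 (l e), |x - y| < δ →
      |u n e x - u n e y| < ε) :
    ∃ φ : ℕ → ℕ, StrictMono φ ∧ ∀ ε > 0, ∃ N, ∀ m ≥ N, ∀ n ≥ N, ∀ e, ∀ x ∈ Icc 0 (l e),
      |u (φ m) e x - u (φ n) e x| < ε := by
  have hmem : ∀ (e : E) (x : Icc (0 : ℝ) 1), l e * x ∈ Icc 0 (l e) := fun e x =>
    ⟨mul_nonneg (hl e).le x.2.1, mul_le_of_le_one_right (hl e).le x.2.2⟩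
  have hequi : ∀ (x₀ : Icc (0 : ℝ) 1) (ε : ℝ), 0 < ε → ∃ δ > 0, ∀ x : Icc (0 : ℝ) 1,
      dist x x₀ < δ → ∀ n e, |u n e (l e * x) - u n e (l e * x₀)| < ε := by
    intro x₀ ε hε
    obtain ⟨δ, hδ, h⟩ := hu ε hε
    have hS : 0 ≤ ∑ e, l e := Finset.sum_nonneg fun e _ => (hl e).le
    refine ⟨δ / (∑ e, l e + 1), by positivity, fun x hx n e => h n e _ (hmem e x) _ (hmem e x₀) ?_⟩
    rw [← mul_sub, abs_mul, abs_of_pos (hl e)]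
    rw [Subtype.dist_eq, Real.dist_eq, lt_div_iff₀ (by positivity)] at hx
    have hle : l e ≤ ∑ e, l e := Finset.single_le_sum (fun e _ => (hl e).le) (Finset.mem_univ e)
    have h0 : 0 ≤ |(x : ℝ) - x₀| := abs_nonneg _
    nlinarith
  -- With every edge parametrized by [0, 1], the family becomes one sequence of maps into the
  -- finite-dimensional space `E → ℝ`.
  let F : ℕ → BoundedContinuousFunction (Icc (0 : ℝ) 1) (E → ℝ) := fun n =>
    BoundedContinuousFunction.mkOfCompact ⟨fun x e => u n e (l e * x), by
      refine continuous_pi fun e => Metric.continuous_iff.2 fun x₀ ε hε => ?_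
      obtain ⟨δ, hδ, h⟩ := hequi x₀ ε hε
      exact ⟨δ, hδ, fun x hx => by rw [Real.dist_eq]; exact h x hx n e⟩⟩
  have hF : ∀ n x e, F n x e = u n e (l e * x) := fun n x e => rfl
  have hM' : 0 ≤ |M| := abs_nonneg M
  have hcomp : IsCompact (closure (range F)) := by
    refine BoundedContinuousFunction.arzela_ascoli (Metric.closedBall 0 |M|)
      (isCompact_closedBall _ _) _ ?_ ?_
    · rintro _ x ⟨n, rfl⟩
      rw [mem_closedBall_zero_iff, pi_norm_le_iff_of_nonneg hM']
      intro e
      rw [hF, Real.norm_eq_abs]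
      exact (hM n e _ (hmem e x)).trans (le_abs_self M)
    · intro x₀
      rw [Metric.equicontinuousAt_iff]
      intro ε hε
      obtain ⟨δ, hδ, h⟩ := hequi x₀ ε hε
      refine ⟨δ, hδ, ?_⟩
      rintro x hx ⟨_, n, rfl⟩
      show dist (F n x₀) (F n x) < ε
      rw [dist_comm, dist_pi_lt_iff hε]
      intro e
      rw [hF, hF, Real.dist_eq]
      exact h x hx n e
  obtain ⟨G, -, φ, hφ, hG⟩ := hcomp.tendsto_subseq (x := F) fun n => subset_closure ⟨n, rfl⟩
  refine ⟨φ, hφ, fun ε hε => ?_⟩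
  obtain ⟨N, hN⟩ := Metric.cauchySeq_iff.1 hG.cauchySeq ε hε
  refine ⟨N, fun m hm n hn e x hx => ?_⟩
  have hx' : x / l e ∈ Icc (0 : ℝ) 1 :=
    ⟨div_nonneg hx.1 (hl e).le, (div_le_one (hl e)).2 hx.2⟩
  have h1 := (BoundedContinuousFunction.dist_coe_le_dist (⟨x / l e, hx'⟩ : Icc (0 : ℝ) 1)).trans_lt
    (hN m hm n hn)
  have h2 := (dist_le_pi_dist _ _ e).trans_lt h1
  rw [Function.comp_apply, Function.comp_apply, hF, hF, Real.dist_eq, mul_div_cancel₀ _ (hl e).ne'] at h2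
  exact h2

/-! ### Energies on an interval and sup-norm estimates -/

/-- The integral of `|g|^p` over `[0, L]`. -/
noncomputable def lpEnergy (L p : ℝ) (g : ℝ → ℝ) : ℝ := ∫ x in (0 : ℝ)..L, |g x| ^ p

section lpEnergy

variable {L p : ℝ} {f g : ℝ → ℝ}

theorem lpEnergy_nonneg (hL : 0 < L) : 0 ≤ lpEnergy L p g :=
  intervalIntegral.integral_nonneg hL.le fun _ _ => by positivity

theorem lpEnergy_eq_setIntegral (hL : 0 < L) :
    lpEnergy L p g = ∫ x in Ioo 0 L, |g x| ^ p := by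
  rw [lpEnergy, intervalIntegral.integral_of_le hL.le, integral_Ioc_eq_integral_Ioo]

theorem lpEnergy_congr (hL : 0 < L) (h : f =ᵐ[volume.restrict (Ioo 0 L)] g) :
    lpEnergy L p f = lpEnergy L p g := by
  rw [lpEnergy_eq_setIntegral hL, lpEnergy_eq_setIntegral hL]
  exact integral_congr_ae (h.mono fun x hx => by simp only [hx])

theorem lpEnergy_const_mul (c : ℝ) :
    lpEnergy L p (fun x => c * g x) = |c| ^ p * lpEnergy L p g := by
  simp only [lpEnergy, abs_mul, Real.mul_rpow (abs_nonneg _) (abs_nonneg _),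
    intervalIntegral.integral_const_mul]

theorem integrableOn_abs_rpow (hp : 0 < p)
    (hg : MemLp g (ENNReal.ofReal p) (volume.restrict (Ioo 0 L))) :
    IntegrableOn (fun x => |g x| ^ p) (Ioo 0 L) := by
  have := hg.integrable_norm_rpow (by simpa using hp) ENNReal.ofReal_ne_top
  rwa [ENNReal.toReal_ofReal hp.le] at this

theorem intervalIntegrable_abs_rpow (hL : 0 < L) (hp : 0 < p)
    (hg : MemLp g (ENNReal.ofReal p) (volume.restrict (Ioo 0 L))) :
    IntervalIntegrable (fun x => |g x| ^ p) volume 0 L := by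
  rw [intervalIntegrable_iff_integrableOn_Ioo_of_le hL.le]
  exact integrableOn_abs_rpow hp hg

theorem lpEnergy_eq_norm_rpow (hL : 0 < L) (hp : 0 < p)
    (hg : MemLp g (ENNReal.ofReal p) (volume.restrict (Ioo 0 L))) :
    lpEnergy L p g = ‖hg.toLp g‖ ^ p := by
  rw [Lp.norm_toLp, hg.eLpNorm_eq_integral_rpow_norm (by simpa using hp) ENNReal.ofReal_ne_top,
    ENNReal.toReal_ofReal hp.le, ENNReal.toReal_ofReal (by positivity), ← Real.rpow_mul
    (by positivity), inv_mul_cancel₀ hp.ne', Real.rpow_one, lpEnergy_eq_setIntegral hL]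
  rfl

/-- If |a| > s, then |a| = |a|^(1-p) |a|^p and the first factor is at most s^(1-p). The free
parameter s lets this replace Hölder's inequality. -/
theorem abs_le_add_rpow {s a : ℝ} (hs : 0 < s) (hp : 1 ≤ p) :
    |a| ≤ s + s ^ (1 - p) * |a| ^ p := by
  rcases le_total |a| s with h | h
  · have : 0 ≤ s ^ (1 - p) * |a| ^ p := by positivity
    linarith
  · have ha : 0 < |a| := hs.trans_le h
    have h1 : |a| = |a| ^ (1 - p) * |a| ^ p := by
      rw [← Real.rpow_add ha, sub_add_cancel, Real.rpow_one]
    have h2 : |a| ^ (1 - p) ≤ s ^ (1 - p) :=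
      Real.rpow_le_rpow_of_nonpos hs h (by linarith)
    have h3 : |a| ^ (1 - p) * |a| ^ p ≤ s ^ (1 - p) * |a| ^ p := by gcongr
    linarith

theorem abs_integral_le_add_lpEnergy (hL : 0 < L) (hp : 1 ≤ p)
    (hg : MemLp g (ENNReal.ofReal p) (volume.restrict (Ioo 0 L))) {s x y : ℝ} (hs : 0 < s)
    (hx : 0 ≤ x) (hxy : x ≤ y) (hy : y ≤ L) :
    |∫ t in x..y, g t| ≤ s * (y - x) + s ^ (1 - p) * lpEnergy L p g := by
  have hsub : uIcc x y ⊆ uIcc 0 L := by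
    rw [uIcc_of_le hxy, uIcc_of_le hL.le]
    exact Icc_subset_Icc hx hy
  have i1 := (MemLp.intervalIntegrable_of_restrict_Ioo hL hp hg).mono_set hsub
  have i0 := intervalIntegrable_abs_rpow hL (by linarith) hg
  have i2 := i0.mono_set hsub
  have h1 : ∫ t in x..y, |g t| ^ p ≤ lpEnergy L p g :=
    intervalIntegral.integral_mono_interval hx hxy hy
      (Filter.Eventually.of_forall fun t => by simp only [Pi.zero_apply]; positivity) i0
  calc |∫ t in x..y, g t| ≤ ∫ t in x..y, |g t| := intervalIntegral.abs_integral_le_integral_abs hxy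
    _ ≤ ∫ t in x..y, (s + s ^ (1 - p) * |g t| ^ p) :=
        intervalIntegral.integral_mono_on hxy i1.abs
          (intervalIntegrable_const.add (i2.const_mul _)) fun t _ => abs_le_add_rpow hs hp
    _ = s * (y - x) + s ^ (1 - p) * ∫ t in x..y, |g t| ^ p := by
        rw [intervalIntegral.integral_add intervalIntegrable_const (i2.const_mul _),
          intervalIntegral.integral_const, intervalIntegral.integral_const_mul, smul_eq_mul,
          mul_comm]
    _ ≤ _ := by gcongr

end lpEnergy

namespace IsLpPrimitive

variable {L p : ℝ} {f g f₁ f₂ g₁ g₂ : ℝ → ℝ}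

theorem congr (h : IsLpPrimitive L p f₁ g) (hL : 0 < L) (hf : ∀ x ∈ Icc 0 L, f₂ x = f₁ x) :
    IsLpPrimitive L p f₂ g :=
  ⟨h.memLp, fun x hx => by rw [hf x hx, hf 0 ⟨le_rfl, hL.le⟩, h.eq x hx]⟩

theorem add (h₁ : IsLpPrimitive L p f₁ g₁) (h₂ : IsLpPrimitive L p f₂ g₂) (hL : 0 < L)
    (hp : 1 ≤ p) : IsLpPrimitive L p (fun x => f₁ x + f₂ x) (fun x => g₁ x + g₂ x) := by
  refine ⟨h₁.memLp.add h₂.memLp, fun x hx => ?_⟩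
  have hs : uIcc 0 x ⊆ uIcc 0 L := by
    rw [uIcc_of_le hx.1, uIcc_of_le hL.le]
    exact Icc_subset_Icc le_rfl hx.2
  rw [intervalIntegral.integral_add ((h₁.intervalIntegrable hL hp).mono_set hs)
    ((h₂.intervalIntegrable hL hp).mono_set hs), h₁.eq x hx, h₂.eq x hx]
  ring

theorem const_mul (h : IsLpPrimitive L p f g) (c : ℝ) :
    IsLpPrimitive L p (fun x => c * f x) (fun x => c * g x) := by
  refine ⟨h.memLp.const_mul c, fun x hx => ?_⟩
  rw [intervalIntegral.integral_const_mul, h.eq x hx]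
  ring

theorem integral_eq_sub (h : IsLpPrimitive L p f g) (hL : 0 < L) (hp : 1 ≤ p) {x y : ℝ}
    (hx : x ∈ Icc 0 L) (hy : y ∈ Icc 0 L) : ∫ t in x..y, g t = f y - f x := by
  have hs : ∀ z ∈ Icc 0 L, uIcc 0 z ⊆ uIcc 0 L := fun z hz => by
    rw [uIcc_of_le hz.1, uIcc_of_le hL.le]
    exact Icc_subset_Icc le_rfl hz.2
  have hi := h.intervalIntegrable hL hp
  rw [h.eq x hx, h.eq y hy, ← intervalIntegral.integral_interval_sub_left
    (hi.mono_set (hs y hy)) (hi.mono_set (hs x hx))]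
  ring

/-- This gives equicontinuity under an energy bound when p > 1: a large s makes the energy term
small, and then a small |x - y| makes the other term small. -/
theorem abs_sub_le (h : IsLpPrimitive L p f g) (hL : 0 < L) (hp : 1 ≤ p) {s x y : ℝ} (hs : 0 < s)
    (hx : x ∈ Icc 0 L) (hy : y ∈ Icc 0 L) :
    |f x - f y| ≤ s * |x - y| + s ^ (1 - p) * lpEnergy L p g := by
  rcases le_total x y with hxy | hxy
  · rw [abs_sub_comm (f x), abs_sub_comm x, ← h.integral_eq_sub hL hp hx hy,
      abs_of_nonneg (sub_nonneg.2 hxy)]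
    exact abs_integral_le_add_lpEnergy hL hp h.memLp hs hx.1 hxy hy.2
  · rw [← h.integral_eq_sub hL hp hy hx, abs_of_nonneg (sub_nonneg.2 hxy)]
    exact abs_integral_le_add_lpEnergy hL hp h.memLp hs hy.1 hxy hx.2

theorem memLp_self (h : IsLpPrimitive L p f g) (hL : 0 < L) (hp : 1 ≤ p) :
    MemLp f (ENNReal.ofReal p) (volume.restrict (Ioo 0 L)) :=
  (h.memW1p hL hp).1

/-- A bound on the sup norm by the norms of `L^p` of the function and its derivative. -/
theorem mul_abs_le (h : IsLpPrimitive L p f g) (hL : 0 < L) (hp : 1 ≤ p) {x : ℝ}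
    (hx : x ∈ Icc 0 L) :
    L * |f x| ≤ L * (1 + L + lpEnergy L p g) + lpEnergy L p f := by
  have i := intervalIntegrable_abs_rpow hL (by linarith) (h.memLp_self hL hp)
  -- A comparison of x with y, with s = 1, to be averaged over y.
  have key : ∀ y ∈ Icc 0 L, |f x| ≤ (1 + L + lpEnergy L p g) + |f y| ^ p := fun y hy => by
    have h1 := h.abs_sub_le hL hp one_pos hx hy
    have h2 : |f y| ≤ 1 + |f y| ^ p := by simpa using abs_le_add_rpow (a := f y) one_pos hp
    have h3 : |x - y| ≤ L := abs_le.2 ⟨by linarith [hx.1, hy.2], by linarith [hx.2, hy.1]⟩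
    have h4 : |f x| ≤ |f x - f y| + |f y| := by simpa using abs_add_le (f x - f y) (f y)
    rw [Real.one_rpow] at h1
    linarith
  have := intervalIntegral.integral_mono_on hL.le intervalIntegrable_const
    (intervalIntegrable_const.add i) key
  rw [intervalIntegral.integral_add intervalIntegrable_const i, intervalIntegral.integral_const,
    intervalIntegral.integral_const, smul_eq_mul, smul_eq_mul, sub_zero] at this
  exact this

end IsLpPrimitive

/-! ### Uniform convexity of L^p -/

/-- If |a| ≠ |b|, this is strict convexity of the power on [0, ∞); otherwise b = -a and the midpoint
is 0. -/
theorem abs_midpoint_rpow_lt {p : ℝ} (hp : 1 < p) {a b : ℝ} (hab : a ≠ b) :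
    |(a + b) / 2| ^ p < (|a| ^ p + |b| ^ p) / 2 := by
  have hp0 : 0 < p := by linarith
  have h1 : |(a + b) / 2| ≤ 2⁻¹ * |a| + 2⁻¹ * |b| := by
    rw [abs_div, abs_two]
    linarith [abs_add_le a b]
  by_cases h : |a| = |b|
  · have hb : b = -a := by
      rcases abs_eq_abs.1 h with h | h
      · exact absurd h hab
      · rw [h, neg_neg]
    have ha : a ≠ 0 := by
      rintro rfl
      simp [hb] at hab
    have : 0 < |a| ^ p := by positivity
    simpa [hb, Real.zero_rpow hp0.ne'] using this
  · have h2 := (strictConvexOn_rpow hp).2 (mem_Ici.2 (abs_nonneg a)) (mem_Ici.2 (abs_nonneg b)) h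
      (by norm_num : (0 : ℝ) < 2⁻¹) (by norm_num : (0 : ℝ) < 2⁻¹) (by norm_num)
    simp only [smul_eq_mul] at h2
    have h3 : |(a + b) / 2| ^ p ≤ (2⁻¹ * |a| + 2⁻¹ * |b|) ^ p := by gcongr
    linarith

/-- A quantitative form of the strict convexity of `|x|^p`, which gives the uniform convexity
of `L^p`. -/
theorem exists_abs_sub_rpow_le {p : ℝ} (hp : 1 < p) {ε : ℝ} (hε : 0 < ε) :
    ∃ C, 0 < C ∧ ∀ a b : ℝ, |a - b| ^ p ≤
      ε * (|a| ^ p + |b| ^ p) + C * ((|a| ^ p + |b| ^ p) / 2 - |(a + b) / 2| ^ p) := by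
  have hp0 : 0 < p := by linarith
  have habs : ∀ f : ℝ × ℝ → ℝ, Continuous f → Continuous fun z => |f z| ^ p := fun f hf =>
    hf.abs.rpow_const fun _ => Or.inr hp0.le
  have hc1 := habs _ continuous_fst
  have hc2 := habs _ continuous_snd
  have hc3 := habs _ (continuous_fst.sub continuous_snd)
  have hc4 := habs _ ((continuous_fst.add continuous_snd).div_const 2)
  -- By homogeneity one may normalize |a|^p + |b|^p = 1. Off `K` the ε term suffices; on the compact
  -- set `K` the convexity gap has a positive lower bound m.
  let K : Set (ℝ × ℝ) := {z | |z.1| ^ p + |z.2| ^ p = 1 ∧ ε ≤ |z.1 - z.2| ^ p}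
  have hle1 : ∀ a b : ℝ, |a| ^ p + |b| ^ p = 1 → |a| ≤ 1 := fun a b h => by
    have : 0 ≤ |b| ^ p := by positivity
    by_contra! hlt
    have := Real.one_lt_rpow hlt hp0
    linarith
  have hK : IsCompact K := by
    refine Metric.isCompact_of_isClosed_isBounded
      ((isClosed_eq (hc1.add hc2) continuous_const).inter (isClosed_le continuous_const hc3)) ?_
    refine (Metric.isBounded_closedBall (x := (0 : ℝ × ℝ)) (r := 1)).subset fun z hz => ?_
    rw [mem_closedBall_zero_iff, Prod.norm_def]
    exact max_le (hle1 _ _ hz.1) (hle1 _ z.1 (by rw [add_comm]; exact hz.1))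
  obtain ⟨m, hm0, hm⟩ := hK.exists_forall_le' (a := 0)
    (f := fun z : ℝ × ℝ => (|z.1| ^ p + |z.2| ^ p) / 2 - |(z.1 + z.2) / 2| ^ p)
    (((hc1.add hc2).div_const 2).sub hc4).continuousOn (fun z hz => by
      refine sub_pos.2 (abs_midpoint_rpow_lt hp fun h => ?_)
      have := hz.2
      rw [h, sub_self, abs_zero, Real.zero_rpow hp0.ne'] at this
      linarith)
  have hnn : ∀ a b : ℝ, 0 ≤ (|a| ^ p + |b| ^ p) / 2 - |(a + b) / 2| ^ p := fun a b => by
    by_cases h : a = b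
    · subst h
      simp
    · exact (sub_pos.2 (abs_midpoint_rpow_lt hp h)).le
  -- Normalized a and b satisfy |a - b| ≤ 2, so a gap of at least m, multiplied by 2^p / m,
  -- dominates |a - b|^p.
  refine ⟨2 ^ p / m, by positivity, ?_⟩
  have hone : ∀ a b : ℝ, |a| ^ p + |b| ^ p = 1 → |a - b| ^ p ≤
      ε + 2 ^ p / m * ((|a| ^ p + |b| ^ p) / 2 - |(a + b) / 2| ^ p) := fun a b h => by
    by_cases hlt : ε ≤ |a - b| ^ p
    · have h1 := hm (a, b) ⟨h, hlt⟩
      simp only at h1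
      have h2 : |a - b| ^ p ≤ 2 ^ p := by
        refine Real.rpow_le_rpow (abs_nonneg _) ?_ hp0.le
        have := abs_sub a b
        linarith [hle1 a b h, hle1 b a (by rw [add_comm]; exact h)]
      have h3 : (2 : ℝ) ^ p / m * m ≤
          2 ^ p / m * ((|a| ^ p + |b| ^ p) / 2 - |(a + b) / 2| ^ p) := by gcongr
      rw [div_mul_cancel₀ _ hm0.ne'] at h3
      linarith
    · have : 0 ≤ 2 ^ p / m * ((|a| ^ p + |b| ^ p) / 2 - |(a + b) / 2| ^ p) :=
        mul_nonneg (by positivity) (hnn a b)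
      linarith
  intro a b
  set S := |a| ^ p + |b| ^ p with hS
  have hS0 : 0 ≤ S := by positivity
  rcases hS0.eq_or_lt with h0 | hpos
  · have ha : |a| ^ p = 0 := by
      have : 0 ≤ |b| ^ p := by positivity
      have : 0 ≤ |a| ^ p := by positivity
      linarith
    have hb : |b| ^ p = 0 := by linarith
    rw [Real.rpow_eq_zero (abs_nonneg _) hp0.ne', abs_eq_zero] at ha hb
    simp [hS, ha, hb, Real.zero_rpow hp0.ne']
  · set r := S ^ p⁻¹ with hr
    have hr0 : 0 < r := by positivity
    have hrp : r ^ p = S := Real.rpow_inv_rpow hS0 hp0.ne'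
    have hscale : ∀ x : ℝ, |x / r| ^ p = |x| ^ p / S := fun x => by
      rw [abs_div, abs_of_pos hr0, Real.div_rpow (abs_nonneg _) hr0.le, hrp]
    have h1 : |a / r| ^ p + |b / r| ^ p = 1 := by
      rw [hscale, hscale, ← add_div, ← hS, div_self hpos.ne']
    have h2 := hone _ _ h1
    rw [h1, ← sub_div, ← add_div, div_right_comm, hscale, hscale, div_le_iff₀ hpos] at h2
    have h3 : (ε + 2 ^ p / m * (1 / 2 - |(a + b) / 2| ^ p / S)) * S =
        ε * S + 2 ^ p / m * (S / 2 - |(a + b) / 2| ^ p) := by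
      field_simp
    rwa [h3] at h2

/-- The pointwise inequality integrated: two functions are close in L^p when their midpoint has
almost the mean of their energies. -/
theorem lpEnergy_sub_le {p ε C : ℝ} (hp : 1 < p)
    (hC : ∀ a b : ℝ, |a - b| ^ p ≤
      ε * (|a| ^ p + |b| ^ p) + C * ((|a| ^ p + |b| ^ p) / 2 - |(a + b) / 2| ^ p))
    {L : ℝ} (hL : 0 < L) {f g : ℝ → ℝ}
    (hf : MemLp f (ENNReal.ofReal p) (volume.restrict (Ioo 0 L)))
    (hg : MemLp g (ENNReal.ofReal p) (volume.restrict (Ioo 0 L))) :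
    lpEnergy L p (fun x => f x - g x) ≤ ε * (lpEnergy L p f + lpEnergy L p g) +
      C * ((lpEnergy L p f + lpEnergy L p g) / 2 - lpEnergy L p (fun x => (f x + g x) / 2)) := by
  have hp0 : 0 < p := by linarith
  have i1 := intervalIntegrable_abs_rpow hL hp0 hf
  have i2 := intervalIntegrable_abs_rpow hL hp0 hg
  have i3 := intervalIntegrable_abs_rpow hL hp0 (hf.sub hg)
  have hm : MemLp (fun x => (f x + g x) / 2) (ENNReal.ofReal p) (volume.restrict (Ioo 0 L)) := by
    simpa only [Pi.add_apply, div_eq_inv_mul] using (hf.add hg).const_mul 2⁻¹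
  have i4 := intervalIntegrable_abs_rpow hL hp0 hm
  have key := intervalIntegral.integral_mono_on hL.le i3
    (((i1.add i2).const_mul ε).add ((((i1.add i2).div_const 2).sub i4).const_mul C))
    fun x _ => hC (f x) (g x)
  rw [intervalIntegral.integral_add ((i1.add i2).const_mul ε)
    ((((i1.add i2).div_const 2).sub i4).const_mul C), intervalIntegral.integral_const_mul,
    intervalIntegral.integral_const_mul, intervalIntegral.integral_sub ((i1.add i2).div_const 2) i4,
    intervalIntegral.integral_div, intervalIntegral.integral_add i1 i2] at key
  exact key

/-! ### Continuity of the energy and completeness of L^p -/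

theorem exists_abs_rpow_sub_abs_rpow_lt {p : ℝ} (hp : 0 < p) (M : ℝ) {ε : ℝ} (hε : 0 < ε) :
    ∃ δ > 0, ∀ a b : ℝ, |a| ≤ M → |b| ≤ M → |a - b| < δ → |(|a| ^ p - |b| ^ p)| < ε := by
  have hc : Continuous fun x : ℝ => |x| ^ p := continuous_abs.rpow_const fun _ => Or.inr hp.le
  have hu := (isCompact_Icc (a := -M) (b := M)).uniformContinuousOn_of_continuous hc.continuousOn
  obtain ⟨δ, hδ, h⟩ := Metric.uniformContinuousOn_iff.1 hu ε hε
  exact ⟨δ, hδ, fun a b ha hb hab => h a (abs_le.1 ha) b (abs_le.1 hb) hab⟩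

theorem abs_lpEnergy_sub_le {L p ε : ℝ} (hL : 0 < L) (hp : 0 < p) {f g : ℝ → ℝ}
    (hf : MemLp f (ENNReal.ofReal p) (volume.restrict (Ioo 0 L)))
    (hg : MemLp g (ENNReal.ofReal p) (volume.restrict (Ioo 0 L)))
    (h : ∀ x ∈ Icc 0 L, |(|f x| ^ p - |g x| ^ p)| ≤ ε) :
    |lpEnergy L p f - lpEnergy L p g| ≤ ε * L := by
  have i1 := intervalIntegrable_abs_rpow hL hp hf
  have i2 := intervalIntegrable_abs_rpow hL hp hg
  rw [lpEnergy, lpEnergy, ← intervalIntegral.integral_sub i1 i2]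
  have := intervalIntegral.norm_integral_le_of_norm_le_const (a := 0) (b := L) (C := ε)
    (f := fun x => |f x| ^ p - |g x| ^ p) fun x hx => by
      rw [uIoc_of_le hL.le] at hx
      exact h x (Ioc_subset_Icc_self hx)
  rwa [sub_zero, abs_of_pos hL] at this

open Filter Topology in
theorem tendsto_lpEnergy {L p : ℝ} (hL : 0 < L) (hp : 1 ≤ p) {f : ℕ → ℝ → ℝ} {g : ℝ → ℝ}
    (hf : ∀ n, MemLp (f n) (ENNReal.ofReal p) (volume.restrict (Ioo 0 L)))
    (hg : MemLp g (ENNReal.ofReal p) (volume.restrict (Ioo 0 L)))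
    (h : Tendsto (fun n => lpEnergy L p (fun x => f n x - g x)) atTop (𝓝 0)) :
    Tendsto (fun n => lpEnergy L p (f n)) atTop (𝓝 (lpEnergy L p g)) := by
  have hp0 : 0 < p := by linarith
  have : Fact (1 ≤ ENNReal.ofReal p) := ⟨by simpa using hp⟩
  have e1 : ∀ n, lpEnergy L p (fun x => f n x - g x) = ‖(hf n).toLp - hg.toLp‖ ^ p := fun n => by
    rw [← MemLp.toLp_sub]
    exact lpEnergy_eq_norm_rpow hL hp0 ((hf n).sub hg)
  simp only [e1] at h
  have h2 := h.rpow_const (p := p⁻¹) (Or.inr (by positivity))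
  simp only [Real.rpow_rpow_inv (norm_nonneg _) hp0.ne', Real.zero_rpow (inv_ne_zero hp0.ne')] at h2
  have h3 := (tendsto_iff_norm_sub_tendsto_zero.2 h2).norm.rpow_const (p := p) (Or.inr hp0.le)
  simpa only [← lpEnergy_eq_norm_rpow hL hp0] using h3

open Filter Topology in
/-- Completeness of `L^p(0, L)`. -/
theorem exists_tendsto_lpEnergy_sub {L p : ℝ} (hL : 0 < L) (hp : 1 ≤ p) {f : ℕ → ℝ → ℝ}
    (hf : ∀ n, MemLp (f n) (ENNReal.ofReal p) (volume.restrict (Ioo 0 L)))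
    (h : ∀ ε > 0, ∃ N, ∀ m ≥ N, ∀ n ≥ N, lpEnergy L p (fun x => f m x - f n x) < ε) :
    ∃ g, MemLp g (ENNReal.ofReal p) (volume.restrict (Ioo 0 L)) ∧
      Tendsto (fun n => lpEnergy L p (fun x => f n x - g x)) atTop (𝓝 0) := by
  have hp0 : 0 < p := by linarith
  have : Fact (1 ≤ ENNReal.ofReal p) := ⟨by simpa using hp⟩
  have hcau : CauchySeq fun n => (hf n).toLp := by
    rw [Metric.cauchySeq_iff]
    intro ε hε
    obtain ⟨N, hN⟩ := h (ε ^ p) (by positivity)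
    refine ⟨N, fun m hm n hn => ?_⟩
    have h1 := hN m hm n hn
    have e1 : lpEnergy L p (fun x => f m x - f n x) = ‖(hf m).toLp - (hf n).toLp‖ ^ p := by
      rw [← MemLp.toLp_sub]
      exact lpEnergy_eq_norm_rpow hL hp0 ((hf m).sub (hf n))
    rw [e1, Real.rpow_lt_rpow_iff (norm_nonneg _) hε.le hp0] at h1
    rwa [dist_eq_norm]
  obtain ⟨G, hG⟩ := cauchySeq_tendsto_of_complete hcau
  refine ⟨G, Lp.memLp G, ?_⟩
  have h1 := ((tendsto_iff_norm_sub_tendsto_zero.1 hG).rpow_const (p := p) (Or.inr hp0.le))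
  rw [Real.zero_rpow hp0.ne'] at h1
  refine h1.congr fun n => ?_
  have e1 := lpEnergy_eq_norm_rpow hL hp0 ((hf n).sub (Lp.memLp G))
  rw [MemLp.toLp_sub (hf n) (Lp.memLp G), Lp.toLp_coeFn] at e1
  exact e1.symm

/-! ### Edge energies, the space 𝒳 and the Rayleigh quotient -/

namespace MetricGraph

variable {V E : Type*} {Γ : MetricGraph V E} {p : ℝ} {VD : Set V} {u v : E → ℝ → ℝ}

/-- The integral of `|u|^p` over the edge `e`. -/
noncomputable def mass (Γ : MetricGraph V E) (p : ℝ) (u : E → ℝ → ℝ) (e : E) : ℝ :=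
  lpEnergy (Γ.length e) p (u e)

/-- The integral of `|u'|^p` over the edge `e`. -/
noncomputable def gradEnergy (Γ : MetricGraph V E) (p : ℝ) (u : E → ℝ → ℝ) (e : E) : ℝ :=
  lpEnergy (Γ.length e) p (Γ.grad u e)

theorem mass_nonneg (Γ : MetricGraph V E) (p : ℝ) (u : E → ℝ → ℝ) (e : E) : 0 ≤ Γ.mass p u e :=
  lpEnergy_nonneg (Γ.length_pos e)

theorem gradEnergy_nonneg (Γ : MetricGraph V E) (p : ℝ) (u : E → ℝ → ℝ) (e : E) :
    0 ≤ Γ.gradEnergy p u e :=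
  lpEnergy_nonneg (Γ.length_pos e)

theorem integral_abs_rpow [Fintype E] :
    Γ.integral (fun e x => |u e x| ^ p) = ∑ e, Γ.mass p u e := rfl

theorem integral_abs_grad_rpow [Fintype E] :
    Γ.integral (fun e x => |Γ.grad u e x| ^ p) = ∑ e, Γ.gradEnergy p u e := rfl

theorem MemX.isLpPrimitive (h : Γ.MemX p VD u) (hp : 1 ≤ p) (e : E) :
    IsLpPrimitive (Γ.length e) p (u e) (Γ.grad u e) :=
  (h.1.2 e).isLpPrimitive (Γ.length_pos e) hp (h.1.1.1 e)

theorem MemX.memLp (h : Γ.MemX p VD u) (e : E) :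
    MemLp (u e) (ENNReal.ofReal p) (volume.restrict (Ioo 0 (Γ.length e))) :=
  (h.1.2 e).1

theorem MemX.memLp_grad (h : Γ.MemX p VD u) (hp : 1 ≤ p) (e : E) :
    MemLp (Γ.grad u e) (ENNReal.ofReal p) (volume.restrict (Ioo 0 (Γ.length e))) :=
  (h.isLpPrimitive hp e).memLp

theorem memX_of_isLpPrimitive (hp : 1 ≤ p) {g : E → ℝ → ℝ}
    (h : ∀ e, IsLpPrimitive (Γ.length e) p (u e) (g e))
    (hval : ∃ val : V → ℝ, ∀ e, u e 0 = val (Γ.src e) ∧ u e (Γ.length e) = val (Γ.tgt e))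
    (hD : ∀ e, (Γ.src e ∈ VD → u e 0 = 0) ∧ (Γ.tgt e ∈ VD → u e (Γ.length e) = 0)) :
    Γ.MemX p VD u :=
  ⟨⟨⟨fun e => (h e).continuousOn (Γ.length_pos e) hp, hval⟩,
    fun e => (h e).memW1p (Γ.length_pos e) hp⟩, hD⟩

theorem grad_ae_eq (hp : 1 ≤ p) {g : ℝ → ℝ} {e : E}
    (h : IsLpPrimitive (Γ.length e) p (u e) g) :
    Γ.grad u e =ᵐ[volume.restrict (Ioo 0 (Γ.length e))] g :=
  h.weakDeriv_ae_eq (Γ.length_pos e) hp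

theorem gradEnergy_eq (hp : 1 ≤ p) {g : ℝ → ℝ} {e : E}
    (h : IsLpPrimitive (Γ.length e) p (u e) g) :
    Γ.gradEnergy p u e = lpEnergy (Γ.length e) p g :=
  lpEnergy_congr (Γ.length_pos e) (grad_ae_eq hp h)

theorem MemX.add (hu : Γ.MemX p VD u) (hv : Γ.MemX p VD v) (hp : 1 ≤ p) :
    Γ.MemX p VD (fun e x => u e x + v e x) := by
  obtain ⟨a, ha⟩ := hu.1.1.2
  obtain ⟨b, hb⟩ := hv.1.1.2
  refine memX_of_isLpPrimitive hp (fun e => (hu.isLpPrimitive hp e).add (hv.isLpPrimitive hp e)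
    (Γ.length_pos e) hp) ⟨fun w => a w + b w, fun e => ?_⟩ fun e => ⟨fun h => ?_, fun h => ?_⟩
  · simp only [(ha e).1, (ha e).2, (hb e).1, (hb e).2, and_self]
  · simp only [(hu.2 e).1 h, (hv.2 e).1 h, add_zero]
  · simp only [(hu.2 e).2 h, (hv.2 e).2 h, add_zero]

theorem MemX.const_mul (hu : Γ.MemX p VD u) (hp : 1 ≤ p) (c : ℝ) :
    Γ.MemX p VD (fun e x => c * u e x) := by
  obtain ⟨a, ha⟩ := hu.1.1.2
  refine memX_of_isLpPrimitive hp (fun e => (hu.isLpPrimitive hp e).const_mul c)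
    ⟨fun w => c * a w, fun e => ?_⟩ fun e => ⟨fun h => ?_, fun h => ?_⟩
  · simp only [(ha e).1, (ha e).2, and_self]
  · simp only [(hu.2 e).1 h, mul_zero]
  · simp only [(hu.2 e).2 h, mul_zero]

theorem MemX.grad_add_ae_eq (hu : Γ.MemX p VD u) (hv : Γ.MemX p VD v) (hp : 1 ≤ p) (e : E) :
    Γ.grad (fun e x => u e x + v e x) e =ᵐ[volume.restrict (Ioo 0 (Γ.length e))]
      fun x => Γ.grad u e x + Γ.grad v e x :=
  grad_ae_eq (u := fun e x => u e x + v e x) hp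
    ((hu.isLpPrimitive hp e).add (hv.isLpPrimitive hp e) (Γ.length_pos e) hp)

theorem MemX.grad_const_mul_ae_eq (hu : Γ.MemX p VD u) (hp : 1 ≤ p) (c : ℝ) (e : E) :
    Γ.grad (fun e x => c * u e x) e =ᵐ[volume.restrict (Ioo 0 (Γ.length e))]
      fun x => c * Γ.grad u e x :=
  grad_ae_eq (u := fun e x => c * u e x) hp ((hu.isLpPrimitive hp e).const_mul c)

theorem mass_const_mul (c : ℝ) (e : E) :
    Γ.mass p (fun e x => c * u e x) e = |c| ^ p * Γ.mass p u e :=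
  lpEnergy_const_mul c

theorem MemX.gradEnergy_const_mul (hu : Γ.MemX p VD u) (hp : 1 ≤ p) (c : ℝ) (e : E) :
    Γ.gradEnergy p (fun e x => c * u e x) e = |c| ^ p * Γ.gradEnergy p u e := by
  rw [gradEnergy, lpEnergy_congr (Γ.length_pos e) (hu.grad_const_mul_ae_eq hp c e)]
  exact lpEnergy_const_mul c

-- The function x(ℓ - x) vanishes at both ends of each edge and so meets every vertex condition.
-- This makes the set of Rayleigh quotients non-empty, so that its `sInf` is a true infimum.
variable (Γ p VD) in
theorem exists_memX_isNontrivial [Nonempty E] (hp : 1 ≤ p) :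
    ∃ u, Γ.MemX p VD u ∧ Γ.IsNontrivial u := by
  refine ⟨fun e x => x * (Γ.length e - x), memX_of_isLpPrimitive hp
    (g := fun e x => Γ.length e - 2 * x) (fun e => ⟨?_, fun x _ => ?_⟩) ⟨0, fun e => ?_⟩ fun e => ?_,
    Classical.arbitrary E, Γ.length (Classical.arbitrary E) / 2, ?_⟩
  · have hc : Continuous fun x : ℝ => Γ.length e - 2 * x := by fun_prop
    obtain ⟨C, hC⟩ := isCompact_Icc.exists_bound_of_continuousOn (s := Icc 0 (Γ.length e))
      hc.continuousOn
    refine MemLp.of_bound hc.aestronglyMeasurable C ?_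
    rw [ae_restrict_iff' measurableSet_Ioo]
    exact Filter.Eventually.of_forall fun x hx => hC x (Ioo_subset_Icc_self hx)
  · rw [intervalIntegral.integral_sub (by simp) (Continuous.intervalIntegrable (by fun_prop) _ _),
      intervalIntegral.integral_const_mul]
    simp
    ring
  · simp
  · simp
  · have := Γ.length_pos (Classical.arbitrary E)
    refine ⟨⟨by linarith, by linarith⟩, mul_ne_zero (by linarith) (by linarith)⟩

variable [Fintype E]

theorem MemX.sum_mass_pos (hu : Γ.MemX p VD u) (hp : 0 < p) (hn : Γ.IsNontrivial u) :
    0 < ∑ e, Γ.mass p u e := by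
  obtain ⟨e, x, hx, hne⟩ := hn
  refine Finset.sum_pos' (fun e _ => mass_nonneg Γ p u e) ⟨e, Finset.mem_univ e, ?_⟩
  refine intervalIntegral.integral_pos (Γ.length_pos e) ?_ (fun y _ => by positivity)
    ⟨x, hx, by positivity⟩
  exact (hu.1.1.1 e).abs.rpow_const fun _ _ => Or.inr hp.le

theorem isNontrivial_of_sum_mass_pos (hp : 0 < p) (h : 0 < ∑ e, Γ.mass p u e) :
    Γ.IsNontrivial u := by
  by_contra hn
  simp only [IsNontrivial, not_exists, not_and, not_not] at hn
  refine h.ne' (Finset.sum_eq_zero fun e _ => ?_)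
  rw [mass, lpEnergy, intervalIntegral.integral_congr (g := fun _ => 0), intervalIntegral.integral_zero]
  intro x hx
  rw [uIcc_of_le (Γ.length_pos e).le] at hx
  simp only [hn e x hx, abs_zero, Real.zero_rpow hp.ne']

theorem sum_mass_const_mul (c : ℝ) :
    ∑ e, Γ.mass p (fun e x => c * u e x) e = |c| ^ p * ∑ e, Γ.mass p u e := by
  simp only [mass_const_mul, Finset.mul_sum]

theorem MemX.sum_gradEnergy_const_mul (hu : Γ.MemX p VD u) (hp : 1 ≤ p) (c : ℝ) :
    ∑ e, Γ.gradEnergy p (fun e x => c * u e x) e = |c| ^ p * ∑ e, Γ.gradEnergy p u e := by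
  simp only [hu.gradEnergy_const_mul hp, Finset.mul_sum]

theorem firstEigenvalue_set_bddBelow :
    BddBelow {r | ∃ u, Γ.MemX p VD u ∧ Γ.IsNontrivial u ∧
      r = Γ.integral (fun e x => |Γ.grad u e x| ^ p) / Γ.integral (fun e x => |u e x| ^ p)} := by
  refine ⟨0, ?_⟩
  rintro r ⟨u, -, -, rfl⟩
  rw [integral_abs_grad_rpow, integral_abs_rpow]
  exact div_nonneg (Finset.sum_nonneg fun e _ => gradEnergy_nonneg Γ p u e)
    (Finset.sum_nonneg fun e _ => mass_nonneg Γ p u e)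

theorem firstEigenvalue_nonneg : 0 ≤ Γ.firstEigenvalue p VD := by
  refine Real.sInf_nonneg ?_
  rintro r ⟨u, -, -, rfl⟩
  rw [integral_abs_grad_rpow, integral_abs_rpow]
  exact div_nonneg (Finset.sum_nonneg fun e _ => gradEnergy_nonneg Γ p u e)
    (Finset.sum_nonneg fun e _ => mass_nonneg Γ p u e)

/-- The Rayleigh inequality. -/
theorem MemX.firstEigenvalue_mul_le (hu : Γ.MemX p VD u) (hp : 0 < p) :
    Γ.firstEigenvalue p VD * ∑ e, Γ.mass p u e ≤ ∑ e, Γ.gradEnergy p u e := by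
  by_cases hn : Γ.IsNontrivial u
  · rw [← le_div_iff₀ (hu.sum_mass_pos hp hn)]
    exact csInf_le firstEigenvalue_set_bddBelow ⟨u, hu, hn, rfl⟩
  · have h0 : ∑ e, Γ.mass p u e = 0 := by
      by_contra h
      exact hn (isNontrivial_of_sum_mass_pos hp
        (lt_of_le_of_ne (Finset.sum_nonneg fun e _ => mass_nonneg Γ p u e) (Ne.symm h)))
    rw [h0, mul_zero]
    exact Finset.sum_nonneg fun e _ => gradEnergy_nonneg Γ p u e

/-- There are normalized functions whose energy is arbitrarily close to the infimum. -/
theorem exists_memX_sum_gradEnergy_lt [Nonempty E] (hp : 1 ≤ p) {a : ℝ}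
    (ha : Γ.firstEigenvalue p VD < a) :
    ∃ u, Γ.MemX p VD u ∧ ∑ e, Γ.mass p u e = 1 ∧ ∑ e, Γ.gradEnergy p u e < a := by
  have hp0 : 0 < p := by linarith
  obtain ⟨u₀, hu₀, hn₀⟩ := exists_memX_isNontrivial Γ p VD hp
  have hne : {r | ∃ u, Γ.MemX p VD u ∧ Γ.IsNontrivial u ∧
      r = Γ.integral (fun e x => |Γ.grad u e x| ^ p) /
        Γ.integral (fun e x => |u e x| ^ p)}.Nonempty := ⟨_, u₀, hu₀, hn₀, rfl⟩
  obtain ⟨_, ⟨u, hu, hn, rfl⟩, hlt⟩ := exists_lt_of_csInf_lt hne ha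
  rw [integral_abs_grad_rpow, integral_abs_rpow] at hlt
  have hpos := hu.sum_mass_pos hp0 hn
  set S := ∑ e, Γ.mass p u e
  have hc : |(S ^ p⁻¹)⁻¹| ^ p = S⁻¹ := by
    rw [abs_of_pos (by positivity), Real.inv_rpow (by positivity),
      Real.rpow_inv_rpow hpos.le hp0.ne']
  refine ⟨fun e x => (S ^ p⁻¹)⁻¹ * u e x, hu.const_mul hp _, ?_, ?_⟩
  · rw [sum_mass_const_mul, hc, inv_mul_cancel₀ hpos.ne']
  · rw [hu.sum_gradEnergy_const_mul hp, hc, inv_mul_eq_div]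
    exact hlt

end MetricGraph

/-! ### Compactness and convergence of minimizing sequences -/

theorem exists_rpow_one_sub_mul_lt {p : ℝ} (hp : 1 < p) (K : ℝ) {ε : ℝ} (hε : 0 < ε) :
    ∃ s > 0, s ^ (1 - p) * K < ε := by
  have h1 := (tendsto_rpow_neg_atTop (y := p - 1) (by linarith)).mul_const K
  rw [zero_mul] at h1
  obtain ⟨s, hs, h0⟩ := ((h1.eventually (gt_mem_nhds hε)).and
    (Filter.eventually_gt_atTop 0)).exists
  exact ⟨s, h0, by rwa [neg_sub] at hs⟩

namespace MetricGraph

variable {V E : Type*} {Γ : MetricGraph V E} {p : ℝ} {VD : Set V}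

/-- The compactness of the embedding of `W^{1,p}` of a compact graph into the continuous
functions. -/
theorem exists_subseq_uniformCauchy_of_bounded [Fintype E] (hp : 1 < p) {u : ℕ → E → ℝ → ℝ}
    (hu : ∀ n, Γ.MemX p VD (u n)) {K : ℝ} (hm : ∀ n, ∑ e, Γ.mass p (u n) e ≤ K)
    (hg : ∀ n, ∑ e, Γ.gradEnergy p (u n) e ≤ K) :
    ∃ (M : ℝ) (φ : ℕ → ℕ), (∀ n e, ∀ x ∈ Icc 0 (Γ.length e), |u n e x| ≤ M) ∧ StrictMono φ ∧
      ∀ ε > 0, ∃ N, ∀ m ≥ N, ∀ n ≥ N, ∀ e, ∀ x ∈ Icc 0 (Γ.length e),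
        |u (φ m) e x - u (φ n) e x| < ε := by
  have hm1 : ∀ n e, Γ.mass p (u n) e ≤ K := fun n e =>
    (Finset.single_le_sum (fun e _ => mass_nonneg Γ p (u n) e) (Finset.mem_univ e)).trans (hm n)
  have hg1 : ∀ n e, Γ.gradEnergy p (u n) e ≤ K := fun n e =>
    (Finset.single_le_sum (fun e _ => gradEnergy_nonneg Γ p (u n) e) (Finset.mem_univ e)).trans
      (hg n)
  have hK : 0 ≤ K := (Finset.sum_nonneg fun e _ => mass_nonneg Γ p (u 0) e).trans (hm 0)
  have hM : ∀ n e, ∀ x ∈ Icc 0 (Γ.length e),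
      |u n e x| ≤ ∑ e, ((1 + Γ.length e + K) + K / Γ.length e) := by
    intro n e x hx
    have hl := Γ.length_pos e
    have h1 : |u n e x| ≤ (1 + Γ.length e + K) + K / Γ.length e := by
      have h2 := ((hu n).isLpPrimitive hp.le e).mul_abs_le hl hp.le hx
      have h3 : lpEnergy (Γ.length e) p (Γ.grad (u n) e) ≤ K := hg1 n e
      have h4 : lpEnergy (Γ.length e) p (u n e) ≤ K := hm1 n e
      refine le_of_mul_le_mul_left ?_ hl
      rw [mul_add, mul_div_cancel₀ _ hl.ne']
      have : Γ.length e * (1 + Γ.length e + lpEnergy (Γ.length e) p (Γ.grad (u n) e)) ≤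
        Γ.length e * (1 + Γ.length e + K) := by gcongr
      linarith
    refine h1.trans (Finset.single_le_sum
      (f := fun e => (1 + Γ.length e + K) + K / Γ.length e) (fun e _ => ?_) (Finset.mem_univ e))
    have := Γ.length_pos e
    positivity
  obtain ⟨φ, hφ, h⟩ := exists_subseq_uniformCauchy Γ.length_pos hM fun ε hε => by
    -- s is chosen to make the energy term less than ε/2 for all n; then |x - y| < ε/(2s) handles
    -- the linear term.
    obtain ⟨s, hs, hsK⟩ := exists_rpow_one_sub_mul_lt hp K (half_pos hε)
    refine ⟨ε / (2 * s), by positivity, fun n e x hx y hy hxy => ?_⟩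
    have h1 := ((hu n).isLpPrimitive hp.le e).abs_sub_le (Γ.length_pos e) hp.le hs hx hy
    have h2 : s ^ (1 - p) * lpEnergy (Γ.length e) p (Γ.grad (u n) e) ≤ s ^ (1 - p) * K := by
      gcongr
      exact hg1 n e
    rw [lt_div_iff₀ (by positivity)] at hxy
    linarith
  exact ⟨_, φ, hM, hφ, h⟩

open Filter Topology in
/-- A sequence that converges uniformly and whose gradients converge in `L^p` has its limit
in `𝒳(Γ, V_D)`. -/
theorem exists_memX_tendsto (hp : 1 < p) {u : ℕ → E → ℝ → ℝ} (hu : ∀ n, Γ.MemX p VD (u n)) {M : ℝ}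
    (hM : ∀ n e, ∀ x ∈ Icc 0 (Γ.length e), |u n e x| ≤ M)
    (hc : ∀ ε > 0, ∃ N, ∀ m ≥ N, ∀ n ≥ N, ∀ e, ∀ x ∈ Icc 0 (Γ.length e),
        |u m e x - u n e x| < ε)
    (hg : ∀ e, ∀ ε > 0, ∃ N, ∀ m ≥ N, ∀ n ≥ N,
      lpEnergy (Γ.length e) p (fun x => Γ.grad (u m) e x - Γ.grad (u n) e x) < ε) :
    ∃ w, Γ.MemX p VD w ∧
      (∀ e, Tendsto (fun n => Γ.gradEnergy p (u n) e) atTop (𝓝 (Γ.gradEnergy p w e))) ∧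
      ∀ e, Tendsto (fun n => Γ.mass p (u n) e) atTop (𝓝 (Γ.mass p w e)) := by
  have hp0 : 0 < p := by linarith
  choose g hgL hgt using fun e => exists_tendsto_lpEnergy_sub (Γ.length_pos e) hp.le
    (fun n => (hu n).memLp_grad hp.le e) (hg e)
  have hz : ∀ e, (0 : ℝ) ∈ Icc 0 (Γ.length e) := fun e => ⟨le_rfl, (Γ.length_pos e).le⟩
  have hcau : ∀ e, CauchySeq fun n => u n e 0 := fun e => by
    rw [Metric.cauchySeq_iff]
    intro ε hε
    obtain ⟨N, hN⟩ := hc ε hε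
    exact ⟨N, fun m hm n hn => hN m hm n hn e 0 (hz e)⟩
  choose c hct using fun e => cauchySeq_tendsto_of_complete (hcau e)
  -- The limit is defined as a primitive of the L^p limit of the gradients, so that it is in W^{1,p}
  -- by construction; pointwise convergence is proved afterwards.
  set w : E → ℝ → ℝ := fun e x => c e + ∫ t in (0 : ℝ)..x, g e t with hw
  have hprim : ∀ e, IsLpPrimitive (Γ.length e) p (w e) (g e) := fun e =>
    ⟨hgL e, fun x _ => by simp [hw]⟩
  have hpt : ∀ e, ∀ x ∈ Icc 0 (Γ.length e), Tendsto (fun n => u n e x) atTop (𝓝 (w e x)) := by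
    intro e x hx
    have hl := Γ.length_pos e
    have hs : uIcc 0 x ⊆ uIcc 0 (Γ.length e) := by
      rw [uIcc_of_le hx.1, uIcc_of_le hl.le]
      exact Icc_subset_Icc le_rfl hx.2
    have hint : Tendsto (fun n => ∫ t in (0 : ℝ)..x, (Γ.grad (u n) e t - g e t)) atTop (𝓝 0) := by
      rw [Metric.tendsto_atTop]
      intro ε hε
      set s := ε / (2 * Γ.length e) with hsdef
      have hs0 : 0 < s := by positivity
      have h1 := (hgt e).const_mul (s ^ (1 - p))
      rw [mul_zero] at h1
      obtain ⟨N, hN⟩ := eventually_atTop.1 (h1.eventually (gt_mem_nhds (half_pos hε)))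
      refine ⟨N, fun n hn => ?_⟩
      have h2 := abs_integral_le_add_lpEnergy hl hp.le (((hu n).memLp_grad hp.le e).sub (hgL e))
        hs0 le_rfl hx.1 hx.2
      have h3 : s * (x - 0) ≤ ε / 2 := by
        calc s * (x - 0) ≤ s * Γ.length e := by
              gcongr
              linarith [hx.2]
          _ = ε / 2 := by rw [hsdef]; field_simp
      have h4 := hN n hn
      rw [Real.dist_eq, sub_zero]
      exact h2.trans_lt (by simp only [Pi.sub_def]; linarith)
    have h5 := (hct e).add (hint.add_const (∫ t in (0 : ℝ)..x, g e t))
    rw [zero_add] at h5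
    refine h5.congr fun n => ?_
    rw [intervalIntegral.integral_sub
      ((((hu n).isLpPrimitive hp.le e).intervalIntegrable hl hp.le).mono_set hs)
      (((hprim e).intervalIntegrable hl hp.le).mono_set hs), sub_add_cancel,
      ((hu n).isLpPrimitive hp.le e).eq x hx]
  have hl' : ∀ e, Γ.length e ∈ Icc 0 (Γ.length e) := fun e => ⟨(Γ.length_pos e).le, le_rfl⟩
  choose val hval using fun n => (hu n).1.1.2
  have hmem : Γ.MemX p VD w := by
    -- The vertex values converge at endpoints of edges; at a vertex without edges the default of
    -- `limUnder` is harmless.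
    refine memX_of_isLpPrimitive hp.le hprim
      ⟨fun v => limUnder atTop fun n => val n v, fun e => ⟨?_, ?_⟩⟩ fun e => ⟨fun h => ?_, fun h => ?_⟩
    · exact (((hpt e 0 (hz e)).congr fun n => (hval n e).1).limUnder_eq).symm
    · exact (((hpt e _ (hl' e)).congr fun n => (hval n e).2).limUnder_eq).symm
    · exact tendsto_nhds_unique (hpt e 0 (hz e))
        (tendsto_const_nhds.congr fun n => (((hu n).2 e).1 h).symm)
    · exact tendsto_nhds_unique (hpt e _ (hl' e))
        (tendsto_const_nhds.congr fun n => (((hu n).2 e).2 h).symm)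
  refine ⟨w, hmem, fun e => ?_, fun e => ?_⟩
  · rw [gradEnergy_eq hp.le (hprim e)]
    exact tendsto_lpEnergy (Γ.length_pos e) hp.le (fun n => (hu n).memLp_grad hp.le e) (hgL e)
      (hgt e)
  · have hl := Γ.length_pos e
    rw [Metric.tendsto_atTop]
    intro ε hε
    obtain ⟨δ, hδ, h1⟩ := exists_abs_rpow_sub_abs_rpow_lt hp0 M
      (div_pos (half_pos hε) hl)
    obtain ⟨N, hN⟩ := hc (δ / 2) (half_pos hδ)
    refine ⟨N, fun n hn => ?_⟩
    have h2 := abs_lpEnergy_sub_le hl hp0 ((hu n).memLp e) (hmem.memLp e) (ε := ε / 2 / Γ.length e)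
      fun x hx => (h1 _ _ (hM n e x hx)
        (le_of_tendsto (hpt e x hx).abs (Eventually.of_forall fun n => hM n e x hx)) ?_).le
    · rw [div_mul_cancel₀ _ hl.ne'] at h2
      rw [Real.dist_eq]
      exact h2.trans_lt (half_lt_self hε)
    · have h3 : |u n e x - w e x| ≤ δ / 2 :=
        le_of_tendsto ((tendsto_const_nhds.sub (hpt e x hx)).abs)
          (eventually_atTop.2 ⟨N, fun m hm => (hN n hn m hm e x hx).le⟩)
      linarith

open Filter Topology in
/-- Normalized minimizing sequences converge, along a subsequence, to a minimizer. -/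
theorem exists_subseq_tendsto_minimizer [Fintype E] (hp : 1 < p) {u : ℕ → E → ℝ → ℝ}
    (hu : ∀ n, Γ.MemX p VD (u n)) (hm : ∀ n, ∑ e, Γ.mass p (u n) e = 1)
    (hmin : Tendsto (fun n => ∑ e, Γ.gradEnergy p (u n) e) atTop (𝓝 (Γ.firstEigenvalue p VD))) :
    ∃ (φ : ℕ → ℕ) (w : E → ℝ → ℝ), StrictMono φ ∧ Γ.MemX p VD w ∧ ∑ e, Γ.mass p w e = 1 ∧
      ∑ e, Γ.gradEnergy p w e = Γ.firstEigenvalue p VD ∧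
      (∀ e, Tendsto (fun n => Γ.gradEnergy p (u (φ n)) e) atTop (𝓝 (Γ.gradEnergy p w e))) ∧
      ∀ e, Tendsto (fun n => Γ.mass p (u (φ n)) e) atTop (𝓝 (Γ.mass p w e)) := by
  have hp0 : 0 < p := by linarith
  set lam := Γ.firstEigenvalue p VD with hlam
  have hlam0 : 0 ≤ lam := firstEigenvalue_nonneg
  obtain ⟨K, hK⟩ := hmin.bddAbove_range
  obtain ⟨M, φ, hM, hφ, hcau⟩ := exists_subseq_uniformCauchy_of_bounded hp hu (K := max K 1)
    (fun n => (hm n).trans_le (le_max_right _ _))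
    (fun n => (hK ⟨n, rfl⟩).trans (le_max_left _ _))
  have hmin' := hmin.comp hφ.tendsto_atTop
  -- Uniform closeness keeps the mass of midpoints near 1.
  have hmid : ∀ η > 0, ∃ N, ∀ m ≥ N, ∀ n ≥ N,
      1 - η ≤ ∑ e, Γ.mass p (fun e x => 2⁻¹ * (u (φ m) e x + u (φ n) e x)) e := by
    intro η hη
    have hS : 0 ≤ ∑ e, Γ.length e := Finset.sum_nonneg fun e _ => (Γ.length_pos e).le
    obtain ⟨δ, hδ, h1⟩ := exists_abs_rpow_sub_abs_rpow_lt hp0 M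
      (ε := η / (∑ e, Γ.length e + 1)) (by positivity)
    obtain ⟨N, hN⟩ := hcau δ hδ
    refine ⟨N, fun m hm' n hn => ?_⟩
    have h2 : ∀ e, Γ.mass p (u (φ n)) e - η / (∑ e, Γ.length e + 1) * Γ.length e ≤
        Γ.mass p (fun e x => 2⁻¹ * (u (φ m) e x + u (φ n) e x)) e := fun e => by
      have hmem := ((hu (φ m)).add (hu (φ n)) hp.le).const_mul hp.le 2⁻¹
      have h3 := abs_lpEnergy_sub_le (Γ.length_pos e) hp0 ((hu (φ n)).memLp e) (hmem.memLp e)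
        fun x hx => (h1 _ _ (hM _ e x hx) ?_ ?_).le
      · have h4 := (abs_le.1 h3).2
        simp only [mass]
        linarith
      · have ha := abs_add_le (u (φ m) e x) (u (φ n) e x)
        rw [abs_mul, abs_of_pos (by norm_num : (0 : ℝ) < 2⁻¹)]
        linarith [hM (φ m) e x hx, hM (φ n) e x hx]
      · have ha := hN n hn m hm' e x hx
        have hb : u (φ n) e x - 2⁻¹ * (u (φ m) e x + u (φ n) e x) =
          2⁻¹ * (u (φ n) e x - u (φ m) e x) := by ring
        rw [hb, abs_mul, abs_of_pos (by norm_num : (0 : ℝ) < 2⁻¹)]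
        linarith [abs_nonneg (u (φ n) e x - u (φ m) e x)]
    have h5 := Finset.sum_le_sum fun e (_ : e ∈ Finset.univ) => h2 e
    rw [Finset.sum_sub_distrib, hm, ← Finset.mul_sum] at h5
    have h6 : η / (∑ e, Γ.length e + 1) * ∑ e, Γ.length e ≤ η := by
      rw [div_mul_eq_mul_div, div_le_iff₀ (by positivity)]
      nlinarith
    linarith
  -- The Rayleigh inequality gives the midpoint an energy of at least λ(1 - η), while the mean of
  -- the two energies is below λ + η. The convexity gap is thus below η(1 + λ).
  have hgcau : ∀ ε > 0, ∃ N, ∀ m ≥ N, ∀ n ≥ N, ∑ e, lpEnergy (Γ.length e) p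
      (fun x => Γ.grad (u (φ m)) e x - Γ.grad (u (φ n)) e x) < ε := by
    intro ε hε
    -- As the energies sum to at most 2(λ + 1), the first term is at most ε/2; the choice of η makes
    -- the gap term less than ε/4.
    obtain ⟨C, hC0, hC⟩ := exists_abs_sub_rpow_le hp (ε := ε / (4 * (lam + 1))) (by positivity)
    set η := min 1 (ε / (4 * C * (lam + 1))) with hη
    have hη0 : 0 < η := lt_min one_pos (by positivity)
    obtain ⟨N₁, hN₁⟩ := hmid η hη0
    obtain ⟨N₂, hN₂⟩ := eventually_atTop.1 (hmin'.eventually (gt_mem_nhds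
      (lt_add_of_pos_right lam hη0)))
    refine ⟨max N₁ N₂, fun m hm' n hn => ?_⟩
    have a1 := hN₂ m ((le_max_right _ _).trans hm')
    have a2 := hN₂ n ((le_max_right _ _).trans hn)
    have a3 := hN₁ m ((le_max_left _ _).trans hm') n ((le_max_left _ _).trans hn)
    simp only [Function.comp_apply] at a1 a2
    have hadd := (hu (φ m)).add (hu (φ n)) hp.le
    have a4 := (hadd.const_mul hp.le 2⁻¹).firstEigenvalue_mul_le hp0
    have h1 := Finset.sum_le_sum fun e (_ : e ∈ Finset.univ) => lpEnergy_sub_le hp hC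
      (Γ.length_pos e) ((hu (φ m)).memLp_grad hp.le e) ((hu (φ n)).memLp_grad hp.le e)
    have e1 : ∀ e, lpEnergy (Γ.length e) p
        (fun x => (Γ.grad (u (φ m)) e x + Γ.grad (u (φ n)) e x) / 2) =
        Γ.gradEnergy p (fun e x => 2⁻¹ * (u (φ m) e x + u (φ n) e x)) e := fun e => by
      refine lpEnergy_congr (Γ.length_pos e) ?_
      filter_upwards [hadd.grad_const_mul_ae_eq hp.le 2⁻¹ e,
        (hu (φ m)).grad_add_ae_eq (hu (φ n)) hp.le e] with x h2 h3
      rw [h2, h3, div_eq_inv_mul]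
    simp only [e1] at h1
    rw [Finset.sum_add_distrib, ← Finset.mul_sum, ← Finset.mul_sum, Finset.sum_sub_distrib,
      ← Finset.sum_div, Finset.sum_add_distrib] at h1
    set A := ∑ e, Γ.gradEnergy p (u (φ m)) e
    set B := ∑ e, Γ.gradEnergy p (u (φ n)) e
    have e2 : ∑ e, lpEnergy (Γ.length e) p (Γ.grad (u (φ m)) e) = A := rfl
    have e3 : ∑ e, lpEnergy (Γ.length e) p (Γ.grad (u (φ n)) e) = B := rfl
    rw [e2, e3] at h1
    have a5 : lam * (1 - η) ≤
        ∑ e, Γ.gradEnergy p (fun e x => 2⁻¹ * (u (φ m) e x + u (φ n) e x)) e :=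
      (mul_le_mul_of_nonneg_left a3 hlam0).trans a4
    have hη1 : η ≤ 1 := min_le_left _ _
    have hη2 : η * (4 * C * (lam + 1)) ≤ ε := by
      rw [← le_div_iff₀ (by positivity)]
      exact min_le_right _ _
    have b1 : ε / (4 * (lam + 1)) * (A + B) ≤ ε / (4 * (lam + 1)) * (2 * (lam + 1)) := by
      gcongr
      linarith
    have b2 : ε / (4 * (lam + 1)) * (2 * (lam + 1)) = ε / 2 := by
      field_simp
      norm_num
    have b3 : (A + B) / 2 - ∑ e, Γ.gradEnergy p (fun e x => 2⁻¹ * (u (φ m) e x + u (φ n) e x)) e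
        < η * (1 + lam) := by linarith
    have b4 := mul_lt_mul_of_pos_left b3 hC0
    linarith
  obtain ⟨w, hw, hwg, hwm⟩ := exists_memX_tendsto hp (fun n => hu (φ n)) (fun n => hM (φ n)) hcau
    fun e ε hε => by
      obtain ⟨N, hN⟩ := hgcau ε hε
      exact ⟨N, fun m hm n hn => (Finset.single_le_sum (f := fun e => lpEnergy (Γ.length e) p
        (fun x => Γ.grad (u (φ m)) e x - Γ.grad (u (φ n)) e x))
        (fun e _ => lpEnergy_nonneg (Γ.length_pos e)) (Finset.mem_univ e)).trans_lt (hN m hm n hn)⟩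
  refine ⟨φ, w, hφ, hw, ?_, ?_, hwg, hwm⟩
  · refine tendsto_nhds_unique (tendsto_finsetSum _ fun e _ => hwm e) ?_
    exact tendsto_const_nhds.congr fun n => (hm (φ n)).symm
  · exact tendsto_nhds_unique (tendsto_finsetSum _ fun e _ => hwg e) hmin'

end MetricGraph

/-! ### Minimizers and eigenfunctions -/

/-- For a = 0 the exponent p - 2 may be negative, but the factors a remove the value of the power.
-/
theorem abs_rpow_sub_two_mul_self_mul_self {p : ℝ} (hp : 0 < p) (a : ℝ) :
    |a| ^ (p - 2) * a * a = |a| ^ p := by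
  rcases eq_or_ne a 0 with rfl | ha
  · simp [Real.zero_rpow hp.ne']
  · rw [mul_assoc, ← abs_mul_abs_self, ← sq, ← Real.rpow_natCast |a| 2,
      ← Real.rpow_add (abs_pos.2 ha)]
    norm_num

/-- The Gateaux derivative of the integral of `|f|^p`. -/
theorem hasDerivAt_lpEnergy_add_mul {L p : ℝ} (hL : 0 < L) (hp : 1 < p) {f g : ℝ → ℝ}
    (hf : MemLp f (ENNReal.ofReal p) (volume.restrict (Ioo 0 L)))
    (hg : MemLp g (ENNReal.ofReal p) (volume.restrict (Ioo 0 L))) :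
    HasDerivAt (fun s => lpEnergy L p (fun x => f x + s * g x))
      (p * ∫ x in (0 : ℝ)..L, |f x| ^ (p - 2) * f x * g x) 0 := by
  have hp0 : 0 < p := by linarith
  have hb := integrableOn_abs_rpow hp0 (hf.norm.add hg.norm)
  have hmem : ∀ s : ℝ, MemLp (fun x => f x + s * g x) (ENNReal.ofReal p)
      (volume.restrict (Ioo 0 L)) := fun s => hf.add (hg.const_mul s)
  have hpm : Measurable fun y : ℝ => |y| ^ (p - 2) := (measurable_id.abs).pow_const _
  -- For |s| < 1 both |f + sg| and |g| are at most |f| + |g|, which is in L^p; this yields the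
  -- integrable bound.
  have key := (hasDerivAt_integral_of_dominated_loc_of_deriv_le
    (μ := volume.restrict (Ioo 0 L)) (F := fun s x => |f x + s * g x| ^ p)
    (F' := fun s x => p * |f x + s * g x| ^ (p - 2) * (f x + s * g x) * g x)
    (bound := fun x => p * |(|f x| + |g x|)| ^ p) (x₀ := (0 : ℝ)) (s := Metric.ball 0 1)
    (Metric.ball_mem_nhds _ one_pos)
    (Filter.Eventually.of_forall fun s => (integrableOn_abs_rpow hp0 (hmem s)).aestronglyMeasurable)
    (integrableOn_abs_rpow hp0 (hmem 0)) ?_ ?_ (hb.const_mul p) ?_).2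
  · simp only [zero_mul, add_zero] at key
    rw [intervalIntegral.integral_of_le hL.le, integral_Ioc_eq_integral_Ioo, ← integral_const_mul]
    simp only [lpEnergy_eq_setIntegral hL]
    convert! key using 3
    ring
  · have h1 := (hmem 0).aestronglyMeasurable.aemeasurable
    exact ((((hpm.comp_aemeasurable h1).const_mul p).mul h1).mul
      hg.aestronglyMeasurable.aemeasurable).aestronglyMeasurable
  · refine Filter.Eventually.of_forall fun x s hs => ?_
    rw [mem_ball_zero_iff, Real.norm_eq_abs] at hs
    set y := f x + s * g x
    have hy : |y| ≤ |f x| + |g x| := by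
      refine (abs_add_le _ _).trans ?_
      rw [abs_mul]
      nlinarith [abs_nonneg (g x)]
    have h0 : 0 ≤ |f x| + |g x| := by positivity
    rw [abs_of_nonneg h0, Real.norm_eq_abs, abs_mul, abs_mul, abs_mul, abs_of_pos hp0,
      abs_of_nonneg (Real.rpow_nonneg (abs_nonneg _) _), mul_assoc, mul_assoc]
    refine mul_le_mul_of_nonneg_left ?_ hp0.le
    rcases eq_or_ne y 0 with hy0 | hy0
    · rw [hy0, abs_zero, zero_mul, mul_zero]
      positivity
    · have hy1 := abs_pos.2 hy0
      have e1 : |y| ^ (p - 2) * (|y| * |g x|) = |y| ^ (p - 1) * |g x| := by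
        rw [← mul_assoc, ← Real.rpow_add_one hy1.ne']
        norm_num [sub_add]
      have hS : 0 < |f x| + |g x| := hy1.trans_le hy
      have e2 : (|f x| + |g x|) ^ p = (|f x| + |g x|) ^ (p - 1) * (|f x| + |g x|) := by
        rw [← Real.rpow_add_one hS.ne', sub_add_cancel]
      rw [e1, e2]
      have h3 : |y| ^ (p - 1) ≤ (|f x| + |g x|) ^ (p - 1) :=
        Real.rpow_le_rpow (abs_nonneg _) hy (by linarith)
      have h4 : |g x| ≤ |f x| + |g x| := by linarith [abs_nonneg (f x)]
      gcongr
  · refine Filter.Eventually.of_forall fun x s _ => ?_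
    have h1 : HasDerivAt (fun s => f x + s * g x) (g x) s := by
      simpa using ((hasDerivAt_id s).mul_const (g x)).const_add (f x)
    exact (hasDerivAt_abs_rpow (f x + s * g x) hp).comp s h1

namespace MetricGraph

variable {V E : Type*} {Γ : MetricGraph V E} {p : ℝ} {VD : Set V} {u v : E → ℝ → ℝ}

/-- An eigenfunction has its eigenvalue as Rayleigh quotient. -/
theorem IsEigenfunction.sum_gradEnergy_eq [Fintype E] {lam : ℝ} (hp : 0 < p)
    (hu : Γ.IsEigenfunction p VD lam u) :
    ∑ e, Γ.gradEnergy p u e = lam * ∑ e, Γ.mass p u e := by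
  have h := hu.2.2 u hu.1
  simp only [abs_rpow_sub_two_mul_self_mul_self hp] at h
  exact h

/-- Minimizers of the Rayleigh quotient are eigenfunctions. -/
theorem MemX.isEigenfunction [Fintype E] (hp : 1 < p) (hu : Γ.MemX p VD u)
    (hn : Γ.IsNontrivial u)
    (h : ∑ e, Γ.gradEnergy p u e = Γ.firstEigenvalue p VD * ∑ e, Γ.mass p u e) :
    Γ.IsEigenfunction p VD (Γ.firstEigenvalue p VD) u := by
  have hp0 : 0 < p := by linarith
  refine ⟨hu, hn, fun w hw => ?_⟩
  set lam := Γ.firstEigenvalue p VD with hlam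
  -- Energy minus λ times mass along u + sw: it is nonnegative, vanishes at s = 0, and its
  -- derivative there is p times the defect in the weak equation.
  let Φ : ℝ → ℝ := fun s =>
    ∑ e, lpEnergy (Γ.length e) p (fun x => Γ.grad u e x + s * Γ.grad w e x) -
      lam * ∑ e, lpEnergy (Γ.length e) p (fun x => u e x + s * w e x)
  have hΦ : HasDerivAt Φ
      (∑ e, p * (∫ x in (0 : ℝ)..Γ.length e,
        |Γ.grad u e x| ^ (p - 2) * Γ.grad u e x * Γ.grad w e x) -
        lam * ∑ e, p * ∫ x in (0 : ℝ)..Γ.length e, |u e x| ^ (p - 2) * u e x * w e x) 0 :=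
    (HasDerivAt.fun_sum fun e _ => hasDerivAt_lpEnergy_add_mul (Γ.length_pos e) hp
      (hu.memLp_grad hp.le e) (hw.memLp_grad hp.le e)).sub
    ((HasDerivAt.fun_sum fun e _ => hasDerivAt_lpEnergy_add_mul (Γ.length_pos e) hp
      (hu.memLp e) (hw.memLp e)).const_mul lam)
  have hΦ0 : Φ 0 = 0 := by
    simp only [Φ, zero_mul, add_zero]
    exact sub_eq_zero.2 h
  have hΦn : ∀ s, 0 ≤ Φ s := fun s => by
    have h1 := (hu.add (hw.const_mul hp.le s) hp.le).firstEigenvalue_mul_le hp0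
    have h2 : ∀ e, Γ.gradEnergy p (fun e x => u e x + s * w e x) e =
        lpEnergy (Γ.length e) p (fun x => Γ.grad u e x + s * Γ.grad w e x) := fun e =>
      gradEnergy_eq (u := fun e x => u e x + s * w e x) hp.le
        ((hu.isLpPrimitive hp.le e).add ((hw.isLpPrimitive hp.le e).const_mul s)
          (Γ.length_pos e) hp.le)
    simp only [h2] at h1
    exact sub_nonneg.2 h1
  have h0 := IsLocalMin.hasDerivAt_eq_zero (Filter.Eventually.of_forall fun s => by
    rw [hΦ0]
    exact hΦn s) hΦ
  rw [← Finset.mul_sum, ← Finset.mul_sum, mul_left_comm, ← mul_sub, mul_eq_zero,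
    or_iff_right hp0.ne', sub_eq_zero] at h0
  exact h0

theorem gradEnergy_congr (hp : 1 ≤ p) (hu : Γ.MemX p VD u) {e : E}
    (h : ∀ x ∈ Icc 0 (Γ.length e), v e x = u e x) : Γ.gradEnergy p v e = Γ.gradEnergy p u e :=
  gradEnergy_eq hp ((hu.isLpPrimitive hp e).congr (Γ.length_pos e) h)

theorem mass_congr {e : E} (h : ∀ x ∈ Icc 0 (Γ.length e), v e x = u e x) :
    Γ.mass p v e = Γ.mass p u e := by
  refine lpEnergy_congr (Γ.length_pos e) ?_
  filter_upwards [ae_restrict_mem measurableSet_Ioo] with x hx using h x (Ioo_subset_Icc_self hx)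

/-- If the first eigenvalue is simple, then all normalized minimizers have the same energies. -/
theorem IsSimple.energies_eq [Fintype E] (hp : 1 < p) (hs : Γ.IsSimple p VD (Γ.firstEigenvalue p VD))
    (hu : Γ.MemX p VD u) (hum : ∑ e, Γ.mass p u e = 1)
    (hug : ∑ e, Γ.gradEnergy p u e = Γ.firstEigenvalue p VD)
    (hv : Γ.MemX p VD v) (hvm : ∑ e, Γ.mass p v e = 1)
    (hvg : ∑ e, Γ.gradEnergy p v e = Γ.firstEigenvalue p VD) (e : E) :
    Γ.gradEnergy p v e = Γ.gradEnergy p u e ∧ Γ.mass p v e = Γ.mass p u e := by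
  have hp0 : 0 < p := by linarith
  obtain ⟨c, hc⟩ := hs u v
    (hu.isEigenfunction hp (isNontrivial_of_sum_mass_pos hp0 (by rw [hum]; exact one_pos))
      (by rw [hum, hug, mul_one]))
    (hv.isEigenfunction hp (isNontrivial_of_sum_mass_pos hp0 (by rw [hvm]; exact one_pos))
      (by rw [hvm, hvg, mul_one]))
  have h1 : ∀ e, Γ.mass p v e = |c| ^ p * Γ.mass p u e := fun e =>
    (mass_congr (u := fun e x => c * u e x) (hc e)).trans (mass_const_mul c e)
  have h2 : ∀ e, Γ.gradEnergy p v e = |c| ^ p * Γ.gradEnergy p u e := fun e =>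
    (gradEnergy_congr hp.le (hu.const_mul hp.le c) (hc e)).trans
      (hu.gradEnergy_const_mul hp.le c e)
  have h3 : |c| ^ p = 1 := by
    rw [Finset.sum_congr rfl fun e _ => h1 e, ← Finset.mul_sum, hum, mul_one] at hvm
    exact hvm
  rw [h1, h2, h3, one_mul, one_mul]
  exact ⟨rfl, rfl⟩

end MetricGraph

/-! ### Differentiating an infimum -/

open Filter Topology in
/-- Differentiation of an infimum of quotients `(G i + ((1 + δ / l) ^ (1 - p) - 1) * b i) /
(1 + δ / l * d i)` at `δ = 0`, when near minimizers have nearly constant `b` and `d`. -/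
theorem hasDerivAt_of_stable_minimizers {ι : Type*} {G b d : ι → ℝ} {Λ : ℝ → ℝ} {l lam p b₀ d₀ : ℝ}
    (hΛ : Λ 0 = lam) (hG : ∀ i, lam ≤ G i) (hb : ∀ i, 0 ≤ b i ∧ b i ≤ G i)
    (hd : ∀ i, 0 ≤ d i ∧ d i ≤ 1)
    (hstab : ∀ ε > 0, ∃ η > 0, ∀ i, G i < lam + η → |b i - b₀| < ε ∧ |d i - d₀| < ε)
    (hup : ∀ᶠ δ in 𝓝 (0 : ℝ), Λ δ * (1 + δ / l * d₀) ≤ lam + ((1 + δ / l) ^ (1 - p) - 1) * b₀)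
    (hlow : ∀ᶠ δ in 𝓝 (0 : ℝ), ∃ i,
      G i + ((1 + δ / l) ^ (1 - p) - 1) * b i ≤ (Λ δ + δ ^ 2) * (1 + δ / l * d i)) :
    HasDerivAt Λ (((1 - p) * b₀ - lam * d₀) / l) 0 := by
  set F : ℝ → ℝ := fun δ => (1 + δ / l) ^ (1 - p) - 1 with hF
  have hF0 : F 0 = 0 := by simp [hF]
  have hFd : HasDerivAt F ((1 - p) / l) 0 := by
    have h1 : HasDerivAt (fun δ : ℝ => 1 + δ / l) (1 / l) 0 :=
      ((hasDerivAt_id (0 : ℝ)).div_const l).const_add 1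
    have h2 := (h1.rpow_const (p := 1 - p) (Or.inl (by simp))).sub_const 1
    convert! h2 using 1
    simp
    ring
  have hFc : Tendsto F (𝓝 0) (𝓝 0) := by simpa [hF0] using hFd.continuousAt.tendsto
  have hFs : Tendsto (fun δ => δ⁻¹ * F δ) (𝓝[≠] 0) (𝓝 ((1 - p) / l)) := by
    simpa [hF0] using hasDerivAt_iff_tendsto_slope_zero.1 hFd
  have hid : Tendsto (fun δ : ℝ => δ) (𝓝 0) (𝓝 0) := tendsto_id
  have hdiv : Tendsto (fun δ : ℝ => δ / l) (𝓝 0) (𝓝 0) := by simpa using hid.div_const l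
  have hsmall : ∀ᶠ δ in 𝓝 (0 : ℝ), |δ / l| < 1 / 2 ∧ |F δ| < 1 / 2 := by
    have h1 := hdiv.abs
    have h2 := hFc.abs
    rw [abs_zero] at h1 h2
    exact (h1.eventually (gt_mem_nhds (by norm_num))).and (h2.eventually (gt_mem_nhds (by norm_num)))
  obtain ⟨i₁, -⟩ := hlow.self_of_nhds
  have hne : Nonempty ι := ⟨i₁⟩
  -- Near minimizers for each δ; their error δ² disappears from the difference quotient.
  obtain ⟨i, hi⟩ : ∃ i : ℝ → ι, ∀ᶠ δ in 𝓝 (0 : ℝ),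
      G (i δ) + F δ * b (i δ) ≤ (Λ δ + δ ^ 2) * (1 + δ / l * d (i δ)) :=
    hlow.choice
  have hpos : ∀ δ x : ℝ, |δ / l| < 1 / 2 → 0 ≤ x → x ≤ 1 → 0 < 1 + δ / l * x := fun δ x h h0 h1 => by
    have := (abs_lt.1 h).1
    nlinarith
  have hposd₀ : ∀ᶠ δ in 𝓝 (0 : ℝ), 0 < 1 + δ / l * d₀ := by
    have h1 := (hdiv.mul_const d₀).const_add 1
    rw [zero_mul, add_zero] at h1
    exact h1.eventually (lt_mem_nhds one_pos)
  set U : ℝ → ℝ := fun δ => (lam + F δ * b₀) / (1 + δ / l * d₀) with hU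
  have hUt : Tendsto U (𝓝 0) (𝓝 lam) := by
    have h1 : Tendsto U (𝓝 0) (𝓝 ((lam + 0 * b₀) / (1 + 0 * d₀))) :=
      ((hFc.mul_const b₀).const_add lam).div ((hdiv.mul_const d₀).const_add 1) (by simp)
    simpa using h1
  have hΛU : ∀ᶠ δ in 𝓝 (0 : ℝ), Λ δ ≤ U δ := by
    filter_upwards [hup, hposd₀] with δ h1 h2
    rwa [hU, le_div_iff₀ h2]
  -- Near minimizers for δ are nearly minimal for δ = 0: b ≤ G absorbs the change of the numerator,
  -- and 0 ≤ d ≤ 1 controls the denominator.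
  have hGt : ∀ η > 0, ∀ᶠ δ in 𝓝 (0 : ℝ), G (i δ) < lam + η := by
    intro η hη
    have h1 : Tendsto (fun δ : ℝ => (|U δ| + δ ^ 2) * (1 + |δ / l|) / (1 - |F δ|)) (𝓝 0)
        (𝓝 |lam|) := by
      have h2 : Tendsto (fun δ : ℝ => (|U δ| + δ ^ 2) * (1 + |δ / l|) / (1 - |F δ|)) (𝓝 0)
          (𝓝 ((|lam| + 0 ^ 2) * (1 + |0|) / (1 - |0|))) :=
        ((hUt.abs.add (hid.pow 2)).mul (hdiv.abs.const_add 1)).div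
          (hFc.abs.const_sub 1) (by simp)
      simpa using h2
    have hGn : ∀ δ, 0 ≤ G (i δ) := fun δ => (hb _).1.trans (hb _).2
    have hbd : ∀ᶠ δ in 𝓝 (0 : ℝ), G (i δ) ≤ (|U δ| + δ ^ 2) * (1 + |δ / l|) / (1 - |F δ|) := by
      filter_upwards [hsmall, hi, hΛU] with δ h2 h3 h4
      have h5 : 0 < 1 - |F δ| := by linarith [h2.2]
      rw [le_div_iff₀ h5]
      have h6 : -(|F δ| * G (i δ)) ≤ F δ * b (i δ) := by
        have := neg_abs_le (F δ * b (i δ))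
        rw [abs_mul, abs_of_nonneg (hb (i δ)).1] at this
        have h7 := mul_le_mul_of_nonneg_left (hb (i δ)).2 (abs_nonneg (F δ))
        linarith
      have h8 := hpos δ _ h2.1 (hd (i δ)).1 (hd (i δ)).2
      have h9 : 1 + δ / l * d (i δ) ≤ 1 + |δ / l| := by
        have := le_abs_self (δ / l)
        have := abs_nonneg (δ / l)
        nlinarith [(hd (i δ)).1, (hd (i δ)).2]
      have h10 : (Λ δ + δ ^ 2) * (1 + δ / l * d (i δ)) ≤ (|U δ| + δ ^ 2) * (1 + |δ / l|) := by
        have h11 : Λ δ + δ ^ 2 ≤ |U δ| + δ ^ 2 := by linarith [le_abs_self (U δ)]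
        exact mul_le_mul h11 h9 h8.le (by positivity)
      nlinarith
    have hl0 : 0 ≤ lam := by
      have h5 : ∀ᶠ δ in 𝓝 (0 : ℝ), 0 ≤ (U δ + δ ^ 2) := by
        filter_upwards [hsmall, hi, hΛU] with δ h2 h3 h4
        have h8 := hpos δ _ h2.1 (hd (i δ)).1 (hd (i δ)).2
        have h6 : 0 ≤ G (i δ) + F δ * b (i δ) := by
          have := (abs_lt.1 h2.2).1
          nlinarith [hb (i δ)]
        have := nonneg_of_mul_nonneg_left (h6.trans h3) h8
        linarith
      have h6 := hUt.add (hid.pow 2)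
      simp only [ne_eq, OfNat.ofNat_ne_zero, not_false_eq_true, zero_pow, add_zero] at h6
      exact ge_of_tendsto h6 h5
    rw [abs_of_nonneg hl0] at h1
    filter_upwards [hbd, h1.eventually (gt_mem_nhds (lt_add_of_pos_right lam hη))] with δ h2 h3
    linarith
  have hbt : Tendsto (fun δ => b (i δ)) (𝓝 0) (𝓝 b₀) := by
    rw [Metric.tendsto_nhds]
    intro ε hε
    obtain ⟨η, hη, h⟩ := hstab ε hε
    filter_upwards [hGt η hη] with δ h1 using (h _ h1).1
  have hdt : Tendsto (fun δ => d (i δ)) (𝓝 0) (𝓝 d₀) := by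
    rw [Metric.tendsto_nhds]
    intro ε hε
    obtain ⟨η, hη, h⟩ := hstab ε hε
    filter_upwards [hGt η hη] with δ h1 using (h _ h1).2
  -- Used twice: with the constants b₀, d₀ for the upper bound and with the values at the near
  -- minimizers for the lower one.
  have hslope : ∀ β γ : ℝ → ℝ, Tendsto β (𝓝 0) (𝓝 b₀) → Tendsto γ (𝓝 0) (𝓝 d₀) →
      Tendsto (fun δ => (δ⁻¹ * F δ * β δ - lam / l * γ δ) / (1 + δ / l * γ δ)) (𝓝[≠] 0)
        (𝓝 (((1 - p) * b₀ - lam * d₀) / l)) := by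
    intro β γ hβ hγ
    have hβ' := hβ.mono_left (nhdsWithin_le_nhds (s := {0}ᶜ))
    have hγ' := hγ.mono_left (nhdsWithin_le_nhds (s := {0}ᶜ))
    have hdiv' := hdiv.mono_left (nhdsWithin_le_nhds (s := {0}ᶜ))
    have h1 := ((hFs.mul hβ').sub (hγ'.const_mul (lam / l))).div
      ((hdiv'.mul hγ').const_add 1) (by simp)
    convert! h1 using 2
    rw [zero_mul, add_zero, div_one]
    ring
  have hS1 := hslope (fun _ => b₀) (fun _ => d₀) tendsto_const_nhds tendsto_const_nhds
  have hS2 := (hslope _ _ hbt hdt).sub (hid.mono_left (nhdsWithin_le_nhds (s := {0}ᶜ)))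
  rw [sub_zero] at hS2
  have heq : ∀ δ β γ : ℝ, δ ≠ 0 → 1 + δ / l * γ ≠ 0 →
      δ * ((δ⁻¹ * F δ * β - lam / l * γ) / (1 + δ / l * γ)) =
        (lam + F δ * β) / (1 + δ / l * γ) - lam := fun δ β γ h0 h1 => by
    have h2 : (lam + F δ * β) / (1 + δ / l * γ) - lam =
        (F δ * β - lam / l * γ * δ) / (1 + δ / l * γ) := by
      rw [div_sub' h1]
      congr 1
      ring
    rw [h2, ← mul_div_assoc]
    congr 1
    rw [mul_sub, ← mul_assoc, ← mul_assoc, mul_inv_cancel₀ h0]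
    ring
  have hboth : ∀ᶠ δ in 𝓝[≠] (0 : ℝ), δ ≠ 0 ∧
      Λ δ - lam ≤ δ * ((δ⁻¹ * F δ * b₀ - lam / l * d₀) / (1 + δ / l * d₀)) ∧
      δ * ((δ⁻¹ * F δ * b (i δ) - lam / l * d (i δ)) / (1 + δ / l * d (i δ)) - δ) ≤ Λ δ - lam := by
    filter_upwards [self_mem_nhdsWithin, nhdsWithin_le_nhds hΛU, nhdsWithin_le_nhds hi,
      nhdsWithin_le_nhds hsmall, nhdsWithin_le_nhds hposd₀] with δ h0 h1 h2 h3 h4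
    have h5 := hpos δ _ h3.1 (hd (i δ)).1 (hd (i δ)).2
    refine ⟨h0, ?_, ?_⟩
    · rw [heq _ _ _ h0 h4.ne']
      exact sub_le_sub_right h1 _
    · rw [mul_sub, heq _ _ _ h0 h5.ne']
      have h6 : (lam + F δ * b (i δ)) / (1 + δ / l * d (i δ)) ≤ Λ δ + δ ^ 2 := by
        rw [div_le_iff₀ h5]
        linarith [hG (i δ)]
      nlinarith
  rw [hasDerivAt_iff_tendsto_slope_zero]
  -- Division by a negative δ exchanges the two bounds, so the slope is squeezed between their
  -- minimum and maximum.
  have hmin := hS1.min hS2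
  have hmax := hS1.max hS2
  rw [min_self] at hmin
  rw [max_self] at hmax
  refine tendsto_of_tendsto_of_tendsto_of_le_of_le' hmin hmax ?_ ?_
  · filter_upwards [hboth] with δ h
    obtain ⟨h0, h1, h2⟩ := h
    rw [zero_add, hΛ, smul_eq_mul]
    rcases lt_or_gt_of_ne h0 with hneg | hpos'
    · refine (min_le_left _ _).trans ?_
      have := mul_le_mul_of_nonpos_left h1 (inv_nonpos.2 hneg.le)
      rwa [inv_mul_cancel_left₀ h0] at this
    · refine (min_le_right _ _).trans ?_
      have := mul_le_mul_of_nonneg_left h2 (inv_nonneg.2 hpos'.le)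
      rwa [inv_mul_cancel_left₀ h0] at this
  · filter_upwards [hboth] with δ h
    obtain ⟨h0, h1, h2⟩ := h
    rw [zero_add, hΛ, smul_eq_mul]
    rcases lt_or_gt_of_ne h0 with hneg | hpos'
    · refine le_trans ?_ (le_max_right _ _)
      have := mul_le_mul_of_nonpos_left h2 (inv_nonpos.2 hneg.le)
      rwa [inv_mul_cancel_left₀ h0] at this
    · refine le_trans ?_ (le_max_left _ _)
      have := mul_le_mul_of_nonneg_left h1 (inv_nonneg.2 hpos'.le)
      rwa [inv_mul_cancel_left₀ h0] at this

/-! ### Rescaling edges and the perturbed graph -/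

theorem lpEnergy_comp_mul {L p r : ℝ} (hr : 0 < r) (g : ℝ → ℝ) :
    lpEnergy L p (fun x => g (x * r)) = r⁻¹ * lpEnergy (L * r) p g := by
  rw [lpEnergy, intervalIntegral.integral_comp_mul_right (fun x => |g x| ^ p) hr.ne', zero_mul]
  rfl

/-- Change of scale for primitives. -/
theorem IsLpPrimitive.comp_mul {L p r : ℝ} {f g : ℝ → ℝ} (h : IsLpPrimitive (L * r) p f g)
    (hL : 0 < L) (hr : 0 < r) (hp : 1 ≤ p) :
    IsLpPrimitive L p (fun x => f (x * r)) (fun x => r * g (x * r)) := by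
  have hLr : 0 < L * r := mul_pos hL hr
  have hp0 : 0 < p := by linarith
  refine ⟨MemLp.const_mul ?_ r, fun x hx => ?_⟩
  · have i1 := (h.intervalIntegrable hLr hp).comp_mul_right (c := r)
    have i2 := (intervalIntegrable_abs_rpow hLr hp0 h.memLp).comp_mul_right (c := r)
    rw [zero_div, mul_div_cancel_right₀ _ hr.ne',
      intervalIntegrable_iff_integrableOn_Ioo_of_le hL.le] at i1 i2
    rw [← integrable_norm_rpow_iff i1.aestronglyMeasurable (by simpa using hp0)
      ENNReal.ofReal_ne_top, ENNReal.toReal_ofReal hp0.le]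
    exact i2
  · rw [intervalIntegral.integral_const_mul, intervalIntegral.integral_comp_mul_right _ hr.ne',
      zero_mul, smul_eq_mul, mul_inv_cancel_left₀ hr.ne']
    exact h.eq _ ⟨mul_nonneg hx.1 hr.le, mul_le_mul_of_nonneg_right hx.2 hr.le⟩

namespace MetricGraph

variable {V E : Type*} {Γ : MetricGraph V E} {p : ℝ} {VD : Set V} {u v : E → ℝ → ℝ}

/-- The function on `Γ'` that corresponds to a function on `Γ` when the edges are rescaled. -/
noncomputable def rescale (Γ Γ' : MetricGraph V E) (u : E → ℝ → ℝ) : E → ℝ → ℝ :=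
  fun e x => u e (x * (Γ.length e / Γ'.length e))

section rescale

variable {Γ' : MetricGraph V E}

theorem MemX.isLpPrimitive_rescale (hu : Γ.MemX p VD u) (hp : 1 ≤ p) (e : E) :
    IsLpPrimitive (Γ'.length e) p (rescale Γ Γ' u e)
      (fun x => Γ.length e / Γ'.length e * Γ.grad u e (x * (Γ.length e / Γ'.length e))) := by
  refine IsLpPrimitive.comp_mul ?_ (Γ'.length_pos e)
    (div_pos (Γ.length_pos e) (Γ'.length_pos e)) hp
  rw [mul_div_cancel₀ _ (Γ'.length_pos e).ne']
  exact hu.isLpPrimitive hp e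

theorem MemX.rescale (hu : Γ.MemX p VD u) (hp : 1 ≤ p) (hs : Γ'.src = Γ.src)
    (ht : Γ'.tgt = Γ.tgt) : Γ'.MemX p VD (rescale Γ Γ' u) := by
  obtain ⟨val, hval⟩ := hu.1.1.2
  have e0 : ∀ e, MetricGraph.rescale Γ Γ' u e 0 = u e 0 := fun e => by
    simp only [MetricGraph.rescale, zero_mul]
  have e1 : ∀ e, MetricGraph.rescale Γ Γ' u e (Γ'.length e) = u e (Γ.length e) := fun e => by
    simp only [MetricGraph.rescale, mul_div_cancel₀ _ (Γ'.length_pos e).ne']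
  refine memX_of_isLpPrimitive hp (hu.isLpPrimitive_rescale hp) ⟨val, fun e => ?_⟩ fun e => ?_
  · rw [e0, e1, hs, ht]
    exact hval e
  · rw [e0, e1, hs, ht]
    exact hu.2 e

theorem mass_rescale (e : E) :
    Γ'.mass p (rescale Γ Γ' u) e = Γ'.length e / Γ.length e * Γ.mass p u e := by
  have h := lpEnergy_comp_mul (L := Γ'.length e) (p := p)
    (div_pos (Γ.length_pos e) (Γ'.length_pos e)) (u e)
  rw [mul_div_cancel₀ _ (Γ'.length_pos e).ne', inv_div] at h
  exact h

/-- The chain rule contributes the p-th power of the old length over the new, the change of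
variables the inverse ratio. -/
theorem MemX.gradEnergy_rescale (hu : Γ.MemX p VD u) (hp : 1 ≤ p) (e : E) :
    Γ'.gradEnergy p (MetricGraph.rescale Γ Γ' u) e =
      (Γ'.length e / Γ.length e) ^ (1 - p) * Γ.gradEnergy p u e := by
  have hr := div_pos (Γ.length_pos e) (Γ'.length_pos e)
  have hr' := div_pos (Γ'.length_pos e) (Γ.length_pos e)
  rw [gradEnergy_eq hp (hu.isLpPrimitive_rescale hp e), lpEnergy_const_mul,
    lpEnergy_comp_mul hr, mul_div_cancel₀ _ (Γ'.length_pos e).ne', inv_div, abs_of_pos hr,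
    ← inv_div, Real.inv_rpow hr'.le, Real.rpow_sub hr', Real.rpow_one, ← mul_assoc]
  congr 1
  rw [div_eq_mul_inv (_ / _), mul_comm]

end rescale

end MetricGraph

namespace MetricGraph

variable {V E : Type*} {Γ : MetricGraph V E} {p : ℝ} {VD : Set V} {u : E → ℝ → ℝ}

theorem rescale_rescale {Γ' : MetricGraph V E} :
    rescale Γ Γ' (rescale Γ' Γ u) = u := by
  funext e x
  have h1 := (Γ.length_pos e).ne'
  have h2 := (Γ'.length_pos e).ne'
  simp only [rescale]
  congr 1
  field_simp

section perturb

variable {e₀ : E} {δ : ℝ}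

theorem perturb_length_self (h : 0 < Γ.length e₀ + δ) :
    (Γ.perturb e₀ δ h).length e₀ = Γ.length e₀ + δ :=
  if_pos rfl

theorem perturb_length_of_ne (h : 0 < Γ.length e₀ + δ) {e : E} (he : e ≠ e₀) :
    (Γ.perturb e₀ δ h).length e = Γ.length e :=
  if_neg he

variable [Fintype E]

theorem sum_mass_rescale_perturb (h : 0 < Γ.length e₀ + δ) :
    ∑ e, (Γ.perturb e₀ δ h).mass p (rescale Γ (Γ.perturb e₀ δ h) u) e =
      ∑ e, Γ.mass p u e + δ / Γ.length e₀ * Γ.mass p u e₀ := by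
  classical
  rw [← sub_eq_iff_eq_add', ← Finset.sum_sub_distrib, Finset.sum_eq_single e₀]
  · rw [mass_rescale, perturb_length_self, add_div, div_self (Γ.length_pos e₀).ne']
    ring
  · intro e _ he
    rw [mass_rescale, perturb_length_of_ne h he, div_self (Γ.length_pos e).ne', one_mul, sub_self]
  · simp

theorem MemX.sum_gradEnergy_rescale_perturb (hu : Γ.MemX p VD u) (hp : 1 ≤ p)
    (h : 0 < Γ.length e₀ + δ) :
    ∑ e, (Γ.perturb e₀ δ h).gradEnergy p (MetricGraph.rescale Γ (Γ.perturb e₀ δ h) u) e =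
      ∑ e, Γ.gradEnergy p u e +
        ((1 + δ / Γ.length e₀) ^ (1 - p) - 1) * Γ.gradEnergy p u e₀ := by
  classical
  rw [← sub_eq_iff_eq_add', ← Finset.sum_sub_distrib, Finset.sum_eq_single e₀]
  · rw [hu.gradEnergy_rescale hp, perturb_length_self, add_div, div_self (Γ.length_pos e₀).ne']
    ring
  · intro e _ he
    rw [hu.gradEnergy_rescale hp, perturb_length_of_ne h he, div_self (Γ.length_pos e).ne',
      Real.one_rpow, one_mul, sub_self]
  · simp

/-- The rescaled function is admissible on the perturbed graph; a minimizer on the original graph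
yields the upper bound for λ(δ). -/
theorem MemX.perturbedEigenvalue_mul_le (hu : Γ.MemX p VD u) (hp : 1 ≤ p)
    (h : 0 < Γ.length e₀ + δ) :
    Γ.perturbedEigenvalue p VD e₀ δ * (∑ e, Γ.mass p u e + δ / Γ.length e₀ * Γ.mass p u e₀) ≤
      ∑ e, Γ.gradEnergy p u e +
        ((1 + δ / Γ.length e₀) ^ (1 - p) - 1) * Γ.gradEnergy p u e₀ := by
  rw [perturbedEigenvalue, dif_pos h, ← sum_mass_rescale_perturb h,
    ← hu.sum_gradEnergy_rescale_perturb hp h]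
  exact (hu.rescale (Γ' := Γ.perturb e₀ δ h) hp rfl rfl).firstEigenvalue_mul_le (by linarith)

/-- Near minimizers for the perturbed graph, as normalized functions on the original graph. -/
theorem exists_near_minimizer_perturb (hp : 1 ≤ p) (h : 0 < Γ.length e₀ + δ) {η : ℝ} (hη : 0 < η) :
    ∃ u, Γ.MemX p VD u ∧ ∑ e, Γ.mass p u e = 1 ∧
      ∑ e, Γ.gradEnergy p u e + ((1 + δ / Γ.length e₀) ^ (1 - p) - 1) * Γ.gradEnergy p u e₀ ≤
        (Γ.perturbedEigenvalue p VD e₀ δ + η) * (1 + δ / Γ.length e₀ * Γ.mass p u e₀) := by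
  have hp0 : 0 < p := by linarith
  have : Nonempty E := ⟨e₀⟩
  rw [perturbedEigenvalue, dif_pos h]
  set Γ' := Γ.perturb e₀ δ h with hΓ'
  obtain ⟨w, hw, hwm, hwg⟩ := exists_memX_sum_gradEnergy_lt (Γ := Γ') (VD := VD) hp
    (lt_add_of_pos_right (Γ'.firstEigenvalue p VD) hη)
  have hv : Γ.MemX p VD (MetricGraph.rescale Γ' Γ w) := hw.rescale hp rfl rfl
  set v := MetricGraph.rescale Γ' Γ w with hvdef
  have hvw : MetricGraph.rescale Γ Γ' v = w := rescale_rescale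
  have hm := sum_mass_rescale_perturb (p := p) (u := v) h
  have hg := hv.sum_gradEnergy_rescale_perturb hp h
  rw [← hΓ', hvw] at hm hg
  rw [hwm] at hm
  have hS : 0 < ∑ e, Γ.mass p v e := by
    refine hv.sum_mass_pos hp0 ?_
    by_contra hn
    have h1 : ∀ e, Γ.mass p v e = 0 := fun e => by
      by_contra hne
      exact hn (isNontrivial_of_sum_mass_pos hp0 (Finset.sum_pos'
        (fun e _ => mass_nonneg Γ p v e)
        ⟨e, Finset.mem_univ e, lt_of_le_of_ne (mass_nonneg Γ p v e) (Ne.symm hne)⟩))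
    simp [h1] at hm
  set S := ∑ e, Γ.mass p v e with hSdef
  have hc : |(S ^ p⁻¹)⁻¹| ^ p = S⁻¹ := by
    rw [abs_of_pos (by positivity), Real.inv_rpow (by positivity),
      Real.rpow_inv_rpow hS.le hp0.ne']
  refine ⟨fun e x => (S ^ p⁻¹)⁻¹ * v e x, hv.const_mul hp _, ?_, ?_⟩
  · rw [sum_mass_const_mul, hc, inv_mul_cancel₀ hS.ne']
  · rw [hv.sum_gradEnergy_const_mul hp, hv.gradEnergy_const_mul hp, mass_const_mul, hc,
      mul_left_comm _ S⁻¹, ← mul_add, ← hg]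
    -- The pulled-back function has mass S with S + (δ/ℓ)·(mass on `e₀`) = 1; dividing by S gives
    -- the new denominator.
    have h2 : 1 + δ / Γ.length e₀ * (S⁻¹ * Γ.mass p v e₀) = S⁻¹ := by
      have : S⁻¹ * (S + δ / Γ.length e₀ * Γ.mass p v e₀) = S⁻¹ := by rw [← hm, mul_one]
      rw [mul_add, inv_mul_cancel₀ hS.ne'] at this
      linarith
    rw [h2, mul_comm]
    exact mul_le_mul_of_nonneg_right hwg.le (by positivity)

end perturb

/-! ### Existence of minimizers, stability and Hadamard's formula -/

variable [Fintype E]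

open Filter Topology in
variable (Γ VD) in
/-- The infimum of the Rayleigh quotients is attained. -/
theorem exists_minimizer [Nonempty E] (hp : 1 < p) :
    ∃ w, Γ.MemX p VD w ∧ ∑ e, Γ.mass p w e = 1 ∧
      ∑ e, Γ.gradEnergy p w e = Γ.firstEigenvalue p VD := by
  choose u hu hum hug using fun n : ℕ => exists_memX_sum_gradEnergy_lt (Γ := Γ) (VD := VD) hp.le
    (lt_add_of_pos_right (Γ.firstEigenvalue p VD) (Nat.one_div_pos_of_nat (n := n) (α := ℝ)))
  have hlim : Tendsto (fun n => ∑ e, Γ.gradEnergy p (u n) e) atTop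
      (𝓝 (Γ.firstEigenvalue p VD)) := by
    refine tendsto_of_tendsto_of_tendsto_of_le_of_le tendsto_const_nhds ?_ (fun n => ?_)
      fun n => (hug n).le
    · simpa using tendsto_one_div_add_atTop_nhds_zero_nat.const_add (Γ.firstEigenvalue p VD)
    · simpa [hum n] using (hu n).firstEigenvalue_mul_le (by linarith)
  obtain ⟨-, w, -, hw, hwm, hwg, -⟩ := exists_subseq_tendsto_minimizer hp hu hum hlim
  exact ⟨w, hw, hwm, hwg⟩

open Filter Topology in
/-- If the first eigenvalue is simple, then normalized functions of nearly minimal energy have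
nearly the energies of a minimizer on each edge. -/
theorem IsSimple.exists_stability (hp : 1 < p) (hs : Γ.IsSimple p VD (Γ.firstEigenvalue p VD))
    (hu : Γ.MemX p VD u) (hum : ∑ e, Γ.mass p u e = 1)
    (hug : ∑ e, Γ.gradEnergy p u e = Γ.firstEigenvalue p VD) (e : E) {ε : ℝ} (hε : 0 < ε) :
    ∃ η > 0, ∀ v, Γ.MemX p VD v → ∑ e, Γ.mass p v e = 1 →
      ∑ e, Γ.gradEnergy p v e < Γ.firstEigenvalue p VD + η →
        |Γ.gradEnergy p v e - Γ.gradEnergy p u e| < ε ∧ |Γ.mass p v e - Γ.mass p u e| < ε := by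
  -- Counterexamples for η = 1/(n + 1) form a minimizing sequence. A subsequence converges to a
  -- minimizer, which by simplicity has the edge energies of u.
  by_contra! hcon
  choose v hv hvm hvg hvn using fun n : ℕ =>
    hcon (1 / ((n : ℝ) + 1)) Nat.one_div_pos_of_nat
  have hlim : Tendsto (fun n => ∑ e, Γ.gradEnergy p (v n) e) atTop
      (𝓝 (Γ.firstEigenvalue p VD)) := by
    refine tendsto_of_tendsto_of_tendsto_of_le_of_le tendsto_const_nhds ?_ (fun n => ?_)
      fun n => (hvg n).le
    · simpa using tendsto_one_div_add_atTop_nhds_zero_nat.const_add (Γ.firstEigenvalue p VD)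
    · simpa [hvm n] using (hv n).firstEigenvalue_mul_le (by linarith)
  obtain ⟨φ, w, -, hw, hwm, hwg, h1, h2⟩ := exists_subseq_tendsto_minimizer hp hv hvm hlim
  obtain ⟨e1, e2⟩ := hs.energies_eq hp hu hum hug hw hwm hwg e
  have h1' := h1 e
  have h2' := h2 e
  rw [e1] at h1'
  rw [e2] at h2'
  obtain ⟨n, a1, a2⟩ := ((Metric.tendsto_nhds.1 h1' ε hε).and (Metric.tendsto_nhds.1 h2' ε hε)).exists
  exact absurd a2 (not_lt.2 (hvn (φ n) a1))

/-- Hadamard's formula in terms of a normalized minimizer. -/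
theorem IsSimple.hasDerivAt_perturbedEigenvalue (hp : 1 < p)
    (hs : Γ.IsSimple p VD (Γ.firstEigenvalue p VD)) (hu : Γ.MemX p VD u)
    (hum : ∑ e, Γ.mass p u e = 1) (hug : ∑ e, Γ.gradEnergy p u e = Γ.firstEigenvalue p VD)
    (e₀ : E) :
    HasDerivAt (Γ.perturbedEigenvalue p VD e₀)
      (((1 - p) * Γ.gradEnergy p u e₀ - Γ.firstEigenvalue p VD * Γ.mass p u e₀) / Γ.length e₀)
      0 := by
  have hp0 : 0 < p := by linarith
  have hnear : ∀ᶠ δ in nhds (0 : ℝ), 0 < Γ.length e₀ + δ := by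
    filter_upwards [lt_mem_nhds (neg_lt_zero.2 (Γ.length_pos e₀))] with δ hδ
    linarith
  refine hasDerivAt_of_stable_minimizers
    (ι := {v : E → ℝ → ℝ // Γ.MemX p VD v ∧ ∑ e, Γ.mass p v e = 1})
    (G := fun v => ∑ e, Γ.gradEnergy p v.1 e) (b := fun v => Γ.gradEnergy p v.1 e₀)
    (d := fun v => Γ.mass p v.1 e₀) (Γ.perturbedEigenvalue_zero p VD e₀)
    (fun v => ?_) (fun v => ⟨gradEnergy_nonneg Γ p v.1 e₀, ?_⟩)
    (fun v => ⟨mass_nonneg Γ p v.1 e₀, ?_⟩) (fun ε hε => ?_) ?_ ?_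
  · simpa [v.2.2] using v.2.1.firstEigenvalue_mul_le hp0
  · exact Finset.single_le_sum (fun e _ => gradEnergy_nonneg Γ p v.1 e) (Finset.mem_univ e₀)
  · exact (Finset.single_le_sum (fun e _ => mass_nonneg Γ p v.1 e) (Finset.mem_univ e₀)).trans_eq
      v.2.2
  · obtain ⟨η, hη, h⟩ := hs.exists_stability hp hu hum hug e₀ hε
    exact ⟨η, hη, fun v => h v.1 v.2.1 v.2.2⟩
  · filter_upwards [hnear] with δ hδ
    have h := hu.perturbedEigenvalue_mul_le (e₀ := e₀) hp.le hδ
    rwa [hum, hug] at h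
  · filter_upwards [hnear] with δ hδ
    -- At δ = 0 no error δ² > 0 is available, but the minimizer itself serves.
    rcases eq_or_ne δ 0 with rfl | h0
    · refine ⟨⟨u, hu, hum⟩, ?_⟩
      simp [hug, perturbedEigenvalue_zero]
    · obtain ⟨v, hv, hvm, h⟩ := exists_near_minimizer_perturb (Γ := Γ) (VD := VD) hp.le hδ
        (sq_pos_of_ne_zero h0)
      exact ⟨⟨v, hv, hvm⟩, h⟩

theorem lpNorm_eq_one_iff (hp : 0 < p) : Γ.lpNorm p u = 1 ↔ ∑ e, Γ.mass p u e = 1 := by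
  have h0 : 0 ≤ ∑ e, Γ.mass p u e := Finset.sum_nonneg fun e _ => mass_nonneg Γ p u e
  rw [lpNorm, integral_abs_rpow, ← Real.rpow_left_inj (Real.rpow_nonneg h0 _) zero_le_one hp.ne',
    one_div, Real.rpow_inv_rpow h0 hp.ne', Real.one_rpow]

end MetricGraph

theorem mainTheorem3 {V E : Type*} [Finite V] [Fintype E] (Γ : MetricGraph V E)
    (hΓ : Γ.Connected) (VD : Set V) (hVD : VD.Nonempty) (p : ℝ) (hp : 1 < p) (e₀ : E)
    (hsimple : Γ.IsSimple p VD (Γ.firstEigenvalue p VD)) :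
    DifferentiableAt ℝ (Γ.perturbedEigenvalue p VD e₀) 0 ∧
    (∃ u₀, Γ.IsEigenfunction p VD (Γ.perturbedEigenvalue p VD e₀ 0) u₀ ∧ Γ.lpNorm p u₀ = 1) ∧
    ∀ u₀, Γ.IsEigenfunction p VD (Γ.perturbedEigenvalue p VD e₀ 0) u₀ → Γ.lpNorm p u₀ = 1 →
      deriv (Γ.perturbedEigenvalue p VD e₀) 0 =
        - ((p - 1) / Γ.length e₀) * (∫ x in (0 : ℝ)..Γ.length e₀, |Γ.grad u₀ e₀ x| ^ p)
        - (Γ.perturbedEigenvalue p VD e₀ 0 / Γ.length e₀) *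
          ∫ x in (0 : ℝ)..Γ.length e₀, |u₀ e₀ x| ^ p := by

  have hp0 : 0 < p := by linarith
  have : Nonempty E := ⟨e₀⟩
  obtain ⟨w, hw, hwm, hwg⟩ := MetricGraph.exists_minimizer Γ VD hp
  rw [Γ.perturbedEigenvalue_zero]
  refine ⟨(hsimple.hasDerivAt_perturbedEigenvalue hp hw hwm hwg e₀).differentiableAt,
    ⟨w, ?_, (MetricGraph.lpNorm_eq_one_iff hp0).2 hwm⟩, fun u₀ hu₀ hn => ?_⟩
  · exact hw.isEigenfunction hp
      (MetricGraph.isNontrivial_of_sum_mass_pos hp0 (by rw [hwm]; exact one_pos))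
      (by rw [hwm, hwg, mul_one])
  -- Testing the equation with u₀ itself shows that a normalized eigenfunction is a minimizer, so
  -- the formula applies to it directly.
  · have hum := (MetricGraph.lpNorm_eq_one_iff hp0).1 hn
    have hug := hu₀.sum_gradEnergy_eq hp0
    rw [hum, mul_one] at hug
    rw [(hsimple.hasDerivAt_perturbedEigenvalue hp hu₀.1 hum hug e₀).deriv]
    simp only [MetricGraph.gradEnergy, MetricGraph.mass, lpEnergy]
    ring
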